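/- Let $K$ be a field of characteristic $0$ and let $L=(L,d,[\cdot,\cdot])$ be a differential graded Lie algebra (DGLA) over $K$: a $\mathbb{Z}$-graded $K$-vector space with a differential $d$ of degree $+1$ and a graded Lie bracket of degree $0$, $d$ being a derivation of the bracket. Write $\bar a$ for the degree of a homogeneous element $a$. A DGLA $L$ is called homotopy abelian if there are DGLAs $N$, $H$ and quasi-isomorphisms of DGLAs $L\leftarrow N\to H$ such that the bracket of $H$ is zero. For a morphism $\chi\colon L'\to L$ of DGLAs, its homotopy fibre is the DGLA $$K(\chi)=\{(l,m(t))\in L'\times L[t,dt]\mid e_0(m(t))=0,\ e_1(m(t))=\chi(l)\},$$ where $L[t,dt]=K[t,dt]\otimes L$, $K[t,dt]=K[t]\oplus K[t]\,dt$ is the de Rham algebra of polynomial forms on the affine line, and $e_s\colon L[t,dt]\to L$ is the evaluation $t\mapsto s$, $dt\mapsto 0$. For a trilinear map $f\colon L\times L\times L\to L$ put, for homogeneous $a,b,c$, $$\oint f(a,b,c)=f(a,b,c)+(-1)^{\bar a(\bar b+\bar c)}f(b,c,a)+(-1)^{\bar c(\bar a+\bar b)}f(c,a,b).$$ **Theorem.**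 Suppose that there exists a bilinear map $h\colon L\times L\to L$ of degree $-1$ such that, for all homogeneous $a,b,c\in L$, 1. $h(a,b)=-(-1)^{\bar a\,\bar b}\,h(b,a)$, 2. $[a,b]=d\,h(a,b)+h(da,b)+(-1)^{\bar a}h(a,db)$, 3. $\oint [h(a,b),c]+\oint h([a,b],c)=0$. Then $L$ is homotopy abelian. If moreover $M\subset L$ is a differential graded Lie subalgebra such that $h(M\times M)\subset M$, then both $M$ and the homotopy fibre of the inclusion $M\subset L$ are homotopy abelian. -/

import Mathlib

open scoped TensorProduct Polynomial

universe u w w'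

/-- A differential graded Lie algebra over `K`: a `ℤ`-graded vector space with a differential of
degree `+1` and a graded Lie bracket of degree `0`. The degree of a value is kept as a separate
index with an equation, so that no transport between equal degrees is needed. -/
structure DGLA (K : Type u) [Field K] where
  /-- The homogeneous component of each degree. -/
  comp : ℤ → Type w
  [addCommGroup : ∀ i, AddCommGroup (comp i)]
  [module : ∀ i, Module K (comp i)]
  /-- The differential. -/
  d : ∀ {i j : ℤ}, i + 1 = j → (comp i →ₗ[K] comp j)
  /-- The bracket. -/
  br : ∀ {i j k : ℤ}, i + j = k → (comp i →ₗ[K] comp j →ₗ[K] comp k)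
  d_d : ∀ {i j k : ℤ} (hij : i + 1 = j) (hjk : j + 1 = k) (a : comp i), d hjk (d hij a) = 0
  /-- `[a, b] = -(-1)^{|a||b|} [b, a]` -/
  br_antisymm : ∀ {i j k : ℤ} (hij : i + j = k) (hji : j + i = k) (a : comp i) (b : comp j),
    br hij a b = -((i * j).negOnePow • br hji b a)
  /-- `d[a, b] = [da, b] + (-1)^{|a|} [a, db]` -/
  leibniz : ∀ {i j k n : ℤ} (hij : i + j = k) (hk : k + 1 = n) (a : comp i) (b : comp j),
    d hk (br hij a b) =
      br (i := i + 1) (by omega) (d rfl a) b +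
        i.negOnePow • br (j := j + 1) (by omega) a (d rfl b)
  /-- `[[a, b], c] + (-1)^{|a|(|b|+|c|)} [[b, c], a] + (-1)^{|c|(|a|+|b|)} [[c, a], b] = 0` -/
  jacobi : ∀ {i j k n : ℤ} (_ : i + j + k = n) (a : comp i) (b : comp j) (c : comp k),
    br (i := i + j) (by omega) (br rfl a b) c +
      (i * (j + k)).negOnePow • br (i := j + k) (by omega) (br rfl b c) a +
      (k * (i + j)).negOnePow • br (i := k + i) (by omega) (br rfl c a) b = (0 : comp n)

namespace DGLA

variable {K : Type u} [Field K]

instance : CoeFun (DGLA.{u, w} K) (fun _ => ℤ → Type w) := ⟨DGLA.comp⟩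

instance (L : DGLA.{u, w} K) (i : ℤ) : AddCommGroup (L i) := L.addCommGroup i

instance (L : DGLA.{u, w} K) (i : ℤ) : Module K (L i) := L.module i

/-- A DGLA is abelian if its bracket is trivial. -/
def IsAbelian (L : DGLA.{u, w} K) : Prop :=
  ∀ {i j k : ℤ} (h : i + j = k) (a : L i) (b : L j), L.br h a b = 0

/-- Morphisms of differential graded Lie algebras. -/
structure Hom (L : DGLA.{u, w} K) (M : DGLA.{u, w'} K) where
  app : ∀ i : ℤ, L i →ₗ[K] M i
  app_d : ∀ {i j : ℤ} (h : i + 1 = j) (a : L i), app j (L.d h a) = M.d h (app i a)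
  app_br : ∀ {i j k : ℤ} (h : i + j = k) (a : L i) (b : L j),
    app k (L.br h a b) = M.br h (app i a) (app j b)

/-! ### Cohomology and quasi-isomorphisms -/

/-- Cocycles of degree `n`. -/
def cocycles (L : DGLA.{u, w} K) (n : ℤ) : Submodule K (L n) :=
  LinearMap.ker (L.d (rfl : n + 1 = n + 1))

/-- Coboundaries of degree `n`. -/
def coboundaries (L : DGLA.{u, w} K) (n : ℤ) : Submodule K (L n) :=
  LinearMap.range (L.d (sub_add_cancel n 1))

/-- The cohomology `H^n(L)`. -/
abbrev cohomology (L : DGLA.{u, w} K) (n : ℤ) : Type w :=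
  L.cocycles n ⧸ (L.coboundaries n).submoduleOf (L.cocycles n)

/-- The map induced on cocycles. -/
def Hom.cocyclesMap {L : DGLA.{u, w} K} {M : DGLA.{u, w'} K} (f : Hom L M) (n : ℤ) :
    L.cocycles n →ₗ[K] M.cocycles n :=
  (f.app n).restrict (fun a ha => by
    simp only [cocycles, LinearMap.mem_ker] at ha ⊢
    rw [← f.app_d, ha, map_zero])

/-- The map induced on cohomology. -/
def Hom.cohomologyMap {L : DGLA.{u, w} K} {M : DGLA.{u, w'} K} (f : Hom L M) (n : ℤ) :
    L.cohomology n →ₗ[K] M.cohomology n :=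
  Submodule.mapQ _ _ (f.cocyclesMap n) (by
    rintro ⟨a, ha⟩ hb
    obtain ⟨c, hc⟩ := hb
    exact ⟨f.app _ c, by rw [← f.app_d, hc]; rfl⟩)

/-- A morphism is a quasi-isomorphism if it is bijective in cohomology. -/
def Hom.IsQuasiIso {L : DGLA.{u, w} K} {M : DGLA.{u, w'} K} (f : Hom L M) : Prop :=
  ∀ n : ℤ, Function.Bijective (f.cohomologyMap n)

/-- `L` is homotopy abelian: there are quasi-isomorphisms of DGLAs `L ← N → H` with `H` abelian.
(The components of `N` and `H` may live in any universe containing `K` and those of `L`.) -/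
def IsHomotopyAbelian (L : DGLA.{u, w} K) : Prop :=
  ∃ (N H : DGLA.{u, max u w} K) (f : Hom N L) (g : Hom N H),
    f.IsQuasiIso ∧ g.IsQuasiIso ∧ H.IsAbelian

/-! ### Subalgebras and products -/

/-- A differential graded Lie subalgebra. -/
structure Sub (L : DGLA.{u, w} K) where
  carrier : ∀ i : ℤ, Submodule K (L i)
  d_mem : ∀ {i j : ℤ} (h : i + 1 = j) {a : L i}, a ∈ carrier i → L.d h a ∈ carrier j
  br_mem : ∀ {i j k : ℤ} (h : i + j = k) {a : L i} {b : L j},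
    a ∈ carrier i → b ∈ carrier j → L.br h a b ∈ carrier k

/-- A subalgebra as a DGLA, with the restricted operations. -/
def Sub.toDGLA {L : DGLA.{u, w} K} (M : L.Sub) : DGLA.{u, w} K where
  comp i := M.carrier i
  d h := (L.d h).restrict (fun _ ha => M.d_mem h ha)
  br {i j k} h := LinearMap.mk₂ K
    (fun (a : M.carrier i) (b : M.carrier j) =>
      (⟨L.br h a.1 b.1, M.br_mem h a.2 b.2⟩ : M.carrier k))
    (fun _ _ _ => Subtype.ext (by simp))
    (fun _ _ _ => Subtype.ext (by simp))
    (fun _ _ _ => Subtype.ext (by simp))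
    (fun _ _ _ => Subtype.ext (by simp))
  d_d hij hjk a := Subtype.ext (L.d_d hij hjk a.1)
  br_antisymm hij hji a b := Subtype.ext (L.br_antisymm hij hji a.1 b.1)
  leibniz hij hk a b := Subtype.ext (L.leibniz hij hk a.1 b.1)
  jacobi h a b c := Subtype.ext (L.jacobi h a.1 b.1 c.1)

/-- The inclusion of a subalgebra. -/
def Sub.incl {L : DGLA.{u, w} K} (M : L.Sub) : Hom M.toDGLA L where
  app i := (M.carrier i).subtype
  app_d _ _ := rfl
  app_br _ _ _ := rfl

/-- The product of two DGLAs, with componentwise operations. -/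
def prod (L : DGLA.{u, w} K) (M : DGLA.{u, w'} K) : DGLA.{u, max w w'} K where
  comp i := L i × M i
  d h := (L.d h).prodMap (M.d h)
  br {i j k} h := LinearMap.mk₂ K
    (fun (a : L i × M i) (b : L j × M j) => ((L.br h a.1 b.1, M.br h a.2 b.2) : L k × M k))
    (fun _ _ _ => Prod.ext (by simp) (by simp))
    (fun _ _ _ => Prod.ext (by simp) (by simp))
    (fun _ _ _ => Prod.ext (by simp) (by simp))
    (fun _ _ _ => Prod.ext (by simp) (by simp))
  d_d hij hjk a := Prod.ext (L.d_d hij hjk a.1) (M.d_d hij hjk a.2)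
  br_antisymm hij hji a b :=
    Prod.ext (L.br_antisymm hij hji a.1 b.1) (M.br_antisymm hij hji a.2 b.2)
  leibniz hij hk a b := Prod.ext (L.leibniz hij hk a.1 b.1) (M.leibniz hij hk a.2 b.2)
  jacobi h a b c := Prod.ext (L.jacobi h a.1 b.1 c.1) (M.jacobi h a.2 b.2 c.2)

/-! ### Polynomial forms and the homotopy fibre -/

/-- Transport between components of equal degree. -/
def castDeg (L : DGLA.{u, w} K) {i j : ℤ} (h : i = j) : L i ≃ₗ[K] L j :=
  LinearEquiv.cast (R := K) (M := L.comp) h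

@[simp] theorem castDeg_rfl (L : DGLA.{u, w} K) {i : ℤ} (h : i = i) (a : L i) :
    L.castDeg h a = a := rfl

/-- The differential of `L` extended to `K[t] ⊗ L`: `p ⊗ a ↦ p ⊗ da`. -/
noncomputable def polyD (L : DGLA.{u, w} K) {i j : ℤ} (h : i + 1 = j) :
    K[X] ⊗[K] L i →ₗ[K] K[X] ⊗[K] L j :=
  (L.d h).lTensor K[X]

/-- The bracket of `L` extended to `K[t] ⊗ L`: `[p ⊗ a, q ⊗ b] = pq ⊗ [a, b]`. -/
noncomputable def polyBr (L : DGLA.{u, w} K) {i j k : ℤ} (h : i + j = k) :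
    K[X] ⊗[K] L i →ₗ[K] K[X] ⊗[K] L j →ₗ[K] K[X] ⊗[K] L k :=
  TensorProduct.map₂ (LinearMap.mul K K[X]) (L.br h)

/-- Differentiation in `t`: `p ⊗ a ↦ p' ⊗ a`. -/
noncomputable def polyDeriv (L : DGLA.{u, w} K) {i j : ℤ} (h : i = j) :
    K[X] ⊗[K] L i →ₗ[K] K[X] ⊗[K] L j :=
  TensorProduct.map Polynomial.derivative (L.castDeg h).toLinearMap

/-- Evaluation `p ⊗ a ↦ p(s) a`. -/
noncomputable def polyEval (L : DGLA.{u, w} K) (s : K) (i : ℤ) :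
    K[X] ⊗[K] L i →ₗ[K] L i :=
  (TensorProduct.lid K (L i)).toLinearMap ∘ₗ (Polynomial.leval s).rTensor (L i)

section
variable (L : DGLA.{u, w} K)

@[simp] theorem polyD_tmul {i j : ℤ} (h : i + 1 = j) (p : K[X]) (a : L i) :
    L.polyD h (p ⊗ₜ a) = p ⊗ₜ L.d h a := rfl

@[simp] theorem polyBr_tmul {i j k : ℤ} (h : i + j = k) (p q : K[X]) (a : L i) (b : L j) :
    L.polyBr h (p ⊗ₜ a) (q ⊗ₜ b) = (p * q) ⊗ₜ L.br h a b := rfl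

@[simp] theorem polyDeriv_tmul {i j : ℤ} (h : i = j) (p : K[X]) (a : L i) :
    L.polyDeriv h (p ⊗ₜ a) = Polynomial.derivative p ⊗ₜ L.castDeg h a := rfl

@[simp] theorem polyEval_tmul (s : K) (i : ℤ) (p : K[X]) (a : L i) :
    L.polyEval s i (p ⊗ₜ a) = p.eval s • a := rfl

theorem polyD_units_smul {i j : ℤ} (h : i + 1 = j) (ε : ℤˣ) (x : K[X] ⊗[K] L i) :
    L.polyD h (ε • x) = ε • L.polyD h x := by
  rcases Int.units_eq_one_or ε with rfl | rfl <;> simp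

theorem polyD_polyD {i j k : ℤ} (hij : i + 1 = j) (hjk : j + 1 = k) (x : K[X] ⊗[K] L i) :
    L.polyD hjk (L.polyD hij x) = 0 := by
  induction x with
  | zero => simp
  | add x y hx hy => simp [hx, hy]
  | tmul p a => simp [L.d_d]

theorem polyD_polyDeriv {i i' j j' : ℤ} (hi : i = i') (hj : j = j') (h : i + 1 = j)
    (h' : i' + 1 = j') (x : K[X] ⊗[K] L i) :
    L.polyD h' (L.polyDeriv hi x) = L.polyDeriv hj (L.polyD h x) := by
  subst hi hj
  induction x with
  | zero => simp
  | add x y hx hy => simp [hx, hy]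
  | tmul p a => simp

theorem polyBr_antisymm {i j k : ℤ} (hij : i + j = k) (hji : j + i = k)
    (x : K[X] ⊗[K] L i) (y : K[X] ⊗[K] L j) :
    L.polyBr hij x y = -((i * j).negOnePow • L.polyBr hji y x) := by
  induction x with
  | zero => simp
  | add x y hx hy => simp [hx, hy]; abel
  | tmul p a =>
    induction y with
    | zero => simp
    | add x y hx hy => simp [hx, hy]; abel
    | tmul q b =>
      rw [polyBr_tmul, polyBr_tmul, L.br_antisymm hij hji, mul_comm]
      rcases Int.even_or_odd (i * j) with h | h <;>
        simp [Int.negOnePow_even, Int.negOnePow_odd, h, TensorProduct.tmul_neg]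

theorem polyBr_leibniz {i j k n i' j' : ℤ} (hij : i + j = k) (hk : k + 1 = n)
    (hi : i + 1 = i') (hj : j + 1 = j') (h₁ : i' + j = n) (h₂ : i + j' = n)
    (x : K[X] ⊗[K] L i) (y : K[X] ⊗[K] L j) :
    L.polyD hk (L.polyBr hij x y) =
      L.polyBr h₁ (L.polyD hi x) y + i.negOnePow • L.polyBr h₂ x (L.polyD hj y) := by
  subst hi hj
  induction x with
  | zero => simp
  | add x y hx hy => simp [hx, hy]; abel
  | tmul p a =>
    induction y with
    | zero => simp
    | add x y hx hy => simp [hx, hy]; abel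
    | tmul q b =>
      simp only [polyBr_tmul, polyD_tmul]
      rw [L.leibniz hij hk]
      rcases Int.even_or_odd i with h | h <;>
        simp [Int.negOnePow_even, Int.negOnePow_odd, h, TensorProduct.tmul_add,
          TensorProduct.tmul_neg]

theorem polyDeriv_polyBr {i j k i' j' k' : ℤ} (hi : i = i') (hj : j = j') (hk : k = k')
    (h : i + j = k) (h₁ : i' + j = k') (h₂ : i + j' = k')
    (x : K[X] ⊗[K] L i) (y : K[X] ⊗[K] L j) :
    L.polyDeriv hk (L.polyBr h x y) =
      L.polyBr h₁ (L.polyDeriv hi x) y + L.polyBr h₂ x (L.polyDeriv hj y) := by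
  subst hi hj hk
  induction x with
  | zero => simp
  | add x y hx hy => simp [hx, hy]; abel
  | tmul p a =>
    induction y with
    | zero => simp
    | add x y hx hy => simp [hx, hy]; abel
    | tmul q b => simp [TensorProduct.add_tmul]

theorem polyBr_jacobi {i j k n ij jk ki : ℤ} (hij : i + j = ij) (hjk : j + k = jk)
    (hki : k + i = ki) (h₁ : ij + k = n) (h₂ : jk + i = n) (h₃ : ki + j = n)
    (x : K[X] ⊗[K] L i) (y : K[X] ⊗[K] L j) (z : K[X] ⊗[K] L k) :
    L.polyBr h₁ (L.polyBr hij x y) z +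
      (i * (j + k)).negOnePow • L.polyBr h₂ (L.polyBr hjk y z) x +
      (k * (i + j)).negOnePow • L.polyBr h₃ (L.polyBr hki z x) y = 0 := by
  subst hij hjk hki
  induction x with
  | zero => simp
  | add x x' hx hx' =>
    have := congrArg₂ (· + ·) hx hx'
    simp only [map_add, LinearMap.add_apply, smul_add, add_zero] at this ⊢
    rw [← this]; abel
  | tmul p a =>
    induction y with
    | zero => simp
    | add x x' hx hx' =>
      have := congrArg₂ (· + ·) hx hx'
      simp only [map_add, LinearMap.add_apply, smul_add, add_zero] at this ⊢
      rw [← this]; abel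
    | tmul q b =>
      induction z with
      | zero => simp
      | add x x' hx hx' =>
        have := congrArg₂ (· + ·) hx hx'
        simp only [map_add, LinearMap.add_apply, smul_add, add_zero] at this ⊢
        rw [← this]; abel
      | tmul r c =>
        have key := congrArg (fun v => (p * q * r) ⊗ₜ[K] v) (L.jacobi (by omega) a b c)
        simp only [polyBr_tmul]
        rw [show q * r * p = p * q * r by ring, show r * p * q = p * q * r by ring]
        rcases Int.even_or_odd (i * (j + k)) with h | h <;>
        rcases Int.even_or_odd (k * (i + j)) with h' | h' <;>
        simpa [Int.negOnePow_even, Int.negOnePow_odd, h, h', TensorProduct.tmul_add,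
          TensorProduct.tmul_neg] using key

/-- The bracket of polynomial forms as a bilinear map on pairs. -/
noncomputable def polyFormsBr {i j k : ℤ} (h : i + j = k) :
    ((K[X] ⊗[K] L i) × (K[X] ⊗[K] L (i - 1))) →ₗ[K]
      ((K[X] ⊗[K] L j) × (K[X] ⊗[K] L (j - 1))) →ₗ[K]
        ((K[X] ⊗[K] L k) × (K[X] ⊗[K] L (k - 1))) :=
  LinearMap.mk₂ K
    (fun x y => (L.polyBr h x.1 y.1,
      L.polyBr (by omega) x.2 y.1 + i.negOnePow • L.polyBr (by omega) x.1 y.2))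
    (fun _ _ _ => Prod.ext (by simp) (by simp; abel))
    (fun _ _ _ => Prod.ext (by simp) (by simp [smul_comm i.negOnePow]))
    (fun _ _ _ => Prod.ext (by simp) (by simp; abel))
    (fun _ _ _ => Prod.ext (by simp) (by simp [smul_comm i.negOnePow]))

/-- The differential of polynomial forms on pairs. -/
noncomputable def polyFormsD {i j : ℤ} (h : i + 1 = j) :
    ((K[X] ⊗[K] L i) × (K[X] ⊗[K] L (i - 1))) →ₗ[K]
      ((K[X] ⊗[K] L j) × (K[X] ⊗[K] L (j - 1))) :=
  LinearMap.prod (L.polyD h ∘ₗ LinearMap.fst K _ _)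
    (L.polyDeriv (by omega) ∘ₗ LinearMap.fst K _ _ -
      L.polyD (by omega) ∘ₗ LinearMap.snd K _ _)

theorem polyFormsBr_apply {i j k : ℤ} (h : i + j = k)
    (x : (K[X] ⊗[K] L i) × (K[X] ⊗[K] L (i - 1)))
    (y : (K[X] ⊗[K] L j) × (K[X] ⊗[K] L (j - 1))) :
    L.polyFormsBr h x y = (L.polyBr h x.1 y.1,
      L.polyBr (by omega) x.2 y.1 + i.negOnePow • L.polyBr (by omega) x.1 y.2) := rfl

theorem polyFormsD_apply {i j : ℤ} (h : i + 1 = j)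
    (x : (K[X] ⊗[K] L i) × (K[X] ⊗[K] L (i - 1))) :
    L.polyFormsD h x = (L.polyD h x.1,
      L.polyDeriv (by omega) x.1 - L.polyD (by omega) x.2) := rfl

/-- The DGLA `L[t, dt] = K[t, dt] ⊗ L`, with `K[t, dt]` the polynomial forms on the affine line.
In degree `i` it is `K[t] ⊗ L^i ⊕ K[t]dt ⊗ L^{i-1}`, a pair `(p ⊗ a, q ⊗ b)` standing for
`p ⊗ a + q dt ⊗ b`. The Koszul rules `d(u ⊗ a) = du ⊗ a + (-1)^{|u|} u ⊗ da` and
`[u ⊗ a, v ⊗ b] = (-1)^{|a||v|} uv ⊗ [a, b]` give the operations on pairs. -/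
noncomputable def polyForms : DGLA.{u, max u w} K where
  comp i := (K[X] ⊗[K] L i) × (K[X] ⊗[K] L (i - 1))
  d h := L.polyFormsD h
  br h := L.polyFormsBr h
  d_d hij hjk x := by
    refine Prod.ext (L.polyD_polyD hij hjk x.1) ?_
    simp only [polyFormsD_apply, map_sub, polyD_polyD, sub_zero, Prod.snd_zero]
    rw [L.polyD_polyDeriv (i := _) (hi := by omega) (hj := by omega) (h := hij), sub_self]
  br_antisymm {i j k} hij hji x y := by
    refine Prod.ext (L.polyBr_antisymm hij hji x.1 y.1) ?_
    simp only [polyFormsBr_apply, Prod.snd_neg, Prod.smul_snd]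
    rw [L.polyBr_antisymm (by omega) (by omega) x.2 y.1,
      L.polyBr_antisymm (by omega) (by omega) x.1 y.2]
    simp only [smul_add, smul_neg, smul_smul, ← Int.negOnePow_add]
    rw [show i + i * (j - 1) = i * j by ring, (Int.negOnePow_eq_iff (i * j + j) ((i - 1) * j)).2
      ⟨j, by ring⟩]
    abel
  leibniz {i j k n} hij hk x y := by
    refine Prod.ext (L.polyBr_leibniz hij hk rfl rfl (by omega) (by omega) x.1 y.1) ?_
    simp only [polyFormsBr_apply, polyFormsD_apply, Prod.snd_add, Prod.smul_snd, map_add,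
      map_sub, LinearMap.sub_apply, smul_add, smul_sub]
    rw [L.polyDeriv_polyBr (i' := i + 1 - 1) (j' := j + 1 - 1) (by omega) (by omega) (by omega)
        hij (by omega) (by omega) x.1 y.1,
      L.polyBr_leibniz (i' := i + 1 - 1) (j' := j + 1) (by omega) (by omega) (by omega) rfl
        (by omega) (by omega) x.2 y.1,
      polyD_units_smul,
      L.polyBr_leibniz (i' := i + 1) (j' := j + 1 - 1) (by omega) (by omega) rfl (by omega)
        (by omega) (by omega) x.1 y.2]
    rcases Int.even_or_odd i with hi | hi
    · simp [Int.negOnePow_even, Int.negOnePow_odd, hi, hi.add_one, hi.sub_odd odd_one]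
      abel
    · simp [Int.negOnePow_even, Int.negOnePow_odd, hi, hi.add_one, hi.sub_odd odd_one]
      abel
  jacobi {i j k n} h x y z := by
    refine Prod.ext (L.polyBr_jacobi rfl rfl rfl (by omega) (by omega) (by omega) x.1 y.1 z.1) ?_
    have h₁ := L.polyBr_jacobi (n := n - 1) (ij := i + j - 1) (jk := j + k) (ki := k + i - 1)
      (by omega) (by omega) (by omega) (by omega) (by omega) (by omega) x.2 y.1 z.1
    have h₂ := L.polyBr_jacobi (n := n - 1) (ij := i + j - 1) (jk := j + k - 1) (ki := k + i)
      (by omega) (by omega) (by omega) (by omega) (by omega) (by omega) x.1 y.2 z.1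
    have h₃ := L.polyBr_jacobi (n := n - 1) (ij := i + j) (jk := j + k - 1) (ki := k + i - 1)
      (by omega) (by omega) (by omega) (by omega) (by omega) (by omega) x.1 y.1 z.2
    have key := congrArg₂ (· + ·) (congrArg₂ (· + ·) h₁
      (congrArg (i.negOnePow • ·) h₂)) (congrArg ((i + j).negOnePow • ·) h₃)
    simp only [add_zero, smul_zero] at key
    rw [Prod.snd_zero, ← key]
    simp only [polyFormsBr_apply, Prod.snd_add, Prod.smul_snd, map_add, smul_add,
      LinearMap.add_apply]
    rcases Int.even_or_odd i with hi | hi <;> rcases Int.even_or_odd j with hj | hj <;>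
    rcases Int.even_or_odd k with hk | hk <;>
    simp [Int.negOnePow_add, Int.negOnePow_sub, Int.negOnePow_even, Int.negOnePow_odd, hi, hj, hk,
      Int.even_mul, Int.even_add, Int.odd_add, Int.even_sub, Int.odd_sub,
      sub_mul, mul_sub, mul_add] <;> abel

/-- The evaluation `e_s : L[t, dt] → L`, `t ↦ s`, `dt ↦ 0`. -/
noncomputable def evalHom (s : K) : Hom L.polyForms L where
  app i := L.polyEval s i ∘ₗ LinearMap.fst K (K[X] ⊗[K] L i) (K[X] ⊗[K] L (i - 1))
  app_d {i j} h x := by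
    obtain ⟨x, x'⟩ := x
    change L.polyEval s j (L.polyD h x) = L.d h (L.polyEval s i x)
    induction x with
    | zero => simp
    | add x y hx hy => simp [hx, hy]
    | tmul p a => simp
  app_br {i j k} h x y := by
    obtain ⟨x, x'⟩ := x
    obtain ⟨y, y'⟩ := y
    change L.polyEval s k (L.polyBr h x y) = L.br h (L.polyEval s i x) (L.polyEval s j y)
    induction x with
    | zero => simp
    | add x y hx hy => simp [hx, hy]
    | tmul p a =>
      induction y with
      | zero => simp
      | add x y hx hy => simp [hx, hy]
      | tmul q b => simp [smul_smul, mul_comm]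

end

/-- The homotopy fibre `K(χ) = {(l, m(t)) ∈ L × M[t, dt] | e₀(m(t)) = 0, e₁(m(t)) = χ(l)}`,
as a subalgebra of `L × M[t, dt]`. -/
noncomputable def homotopyFiberSub {L : DGLA.{u, w} K} {M : DGLA.{u, w'} K} (χ : Hom L M) :
    (L.prod M.polyForms).Sub where
  carrier i :=
    LinearMap.ker ((M.evalHom 0).app i ∘ₗ LinearMap.snd K (L i) (M.polyForms i)) ⊓
      LinearMap.eqLocus ((M.evalHom 1).app i ∘ₗ LinearMap.snd K (L i) (M.polyForms i))
        (χ.app i ∘ₗ LinearMap.fst K (L i) (M.polyForms i))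
  d_mem {i j} h {a} ha := by
    obtain ⟨h0, h1⟩ := ha
    change (M.evalHom 0).app i a.2 = 0 at h0
    change (M.evalHom 1).app i a.2 = χ.app i a.1 at h1
    constructor
    · change (M.evalHom 0).app j (M.polyForms.d h a.2) = 0
      rw [(M.evalHom 0).app_d, h0, map_zero]
    · change (M.evalHom 1).app j (M.polyForms.d h a.2) = χ.app j (L.d h a.1)
      rw [(M.evalHom 1).app_d, h1, χ.app_d]
  br_mem {i j k} h {a b} ha hb := by
    obtain ⟨h0, h1⟩ := ha
    obtain ⟨-, h1'⟩ := hb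
    change (M.evalHom 0).app i a.2 = 0 at h0
    change (M.evalHom 1).app i a.2 = χ.app i a.1 at h1
    change (M.evalHom 1).app j b.2 = χ.app j b.1 at h1'
    constructor
    · change (M.evalHom 0).app k (M.polyForms.br h a.2 b.2) = 0
      rw [(M.evalHom 0).app_br, h0, map_zero, LinearMap.zero_apply]
    · change (M.evalHom 1).app k (M.polyForms.br h a.2 b.2) = χ.app k (L.br h a.1 b.1)
      rw [(M.evalHom 1).app_br, h1, h1', χ.app_br]

/-- The homotopy fibre of a morphism of DGLAs. -/
noncomputable def homotopyFiber {L : DGLA.{u, w} K} {M : DGLA.{u, w'} K} (χ : Hom L M) :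
    DGLA.{u, max u w w'} K :=
  (homotopyFiberSub χ).toDGLA

end DGLA

/-!
The three hypotheses on `h` have a transparent meaning on the Chevalley-Eilenberg chains of `L`,
the supersymmetric algebra `S` of the shift `L[1]`. Its differential is `Q = q₁ + q₂`, with `q₁`
the derivation given by `d` (`diff`) and `q₂` the second order operator given by the bracket
(`brDiff`). Antisymmetry allows `h` to define a second order operator `H` of even parity on `S`
(`BracketHomotopy.op`). The homotopy formula becomes `[H, q₁] = q₂` (`op_mul_diff`) and the cyclic
identity becomes `[H, q₂] = 0` (`op_mul_brDiff`). Hence `exp (-H)`, a finite sum on every element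
because `H` lowers the number of factors, intertwines `Q` with `q₁`. It fixes the generators, and a
generator that is `q₁`-exact is the image of an exact element of `L`, as the linear part of a
primitive shows. So the map `L[1] → (S, Q)` is injective in cohomology (`exists_diff_eq_gen`).

This injectivity implies that `L` is homotopy abelian, without any `L∞`-theory, by Cartan calculus
(`CartanModule.isHomotopyAbelian`). The DGLA `L` acts on `S` by Lie derivatives, which kill `1`,
and multiplication by generators extends this to an action of the cone of the identity of `L`,
which is acyclic. Let `E` be the DGLA of operators on `S` and `E₁ ⊆ E` the subalgebra of the
operators killing `1`. Then `L` maps to the homotopy pullback `F` of the cone and `E₁` over `E`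
(`CartanModule.toFibre`), which is a homotopy fibre of `E₁ ⊆ E`. On the other hand the complex `S`,
shifted and with zero bracket, maps to `F` by sending `s` to `dt ⊗ (x ↦ aug x • s)`, a morphism
since `dt² = 0`; evaluation of operators at `1` shows that it is a quasi-isomorphism
(`CartanModule.isQuasiIso_shiftToFibre`). In cohomology `L → F` is, up to sign, the map `L[1] → (S,
Q)`, so it is injective. The homotopy pullback of `L` and the shifted complex over `F` is then
quasi-isomorphic to `L` and has a morphism to a DGLA with zero bracket which is injective in
cohomology. Retracting the target onto the cohomology ends the argument
(`IsHomotopyAbelian.of_injective`). Only the parity of operators matters, so the grading of `S` is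
forgotten and operators are graded periodically.

For a subalgebra `M` closed under `h`, the restriction of `h` satisfies the same three conditions,
and so does the homotopy fibre of `M ⊆ L`, by the extension of `h` to polynomial forms
(`BracketHomotopy.polyForms`): evaluation at a point commutes with the extension.
-/

namespace DGLA

variable {K : Type u} [Field K]

/-! ### Cohomology in terms of elements -/

theorem d_eq_zero_of_eq (L : DGLA.{u, w} K) {i j k : ℤ} {h : i + 1 = j} (h' : i + 1 = k) {a : L i}
    (ha : L.d h a = 0) : L.d h' a = 0 := by
  subst h h'
  exact ha

theorem Hom.injective_cohomologyMap_iff {L : DGLA.{u, w} K} {M : DGLA.{u, w'} K} (f : Hom L M)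
    (n : ℤ) : Function.Injective (f.cohomologyMap n) ↔
      ∀ a : L n, L.d (rfl : n + 1 = n + 1) a = 0 →
        (∃ b, M.d (sub_add_cancel n 1) b = f.app n a) →
          ∃ c, L.d (sub_add_cancel n 1) c = a := by
  rw [injective_iff_map_eq_zero]
  constructor
  · intro h a ha hb
    have := h (Submodule.Quotient.mk ⟨a, ha⟩)
      ((Submodule.Quotient.mk_eq_zero _).2 (by exact hb))
    exact (Submodule.Quotient.mk_eq_zero _).1 this
  · intro h x hx
    induction x using Submodule.Quotient.induction_on with
    | H a =>
      exact (Submodule.Quotient.mk_eq_zero _).2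
        (h a.1 a.2 ((Submodule.Quotient.mk_eq_zero _).1 hx))

theorem Hom.surjective_cohomologyMap_iff {L : DGLA.{u, w} K} {M : DGLA.{u, w'} K} (f : Hom L M)
    (n : ℤ) : Function.Surjective (f.cohomologyMap n) ↔
      ∀ b : M n, M.d (rfl : n + 1 = n + 1) b = 0 →
        ∃ a, L.d (rfl : n + 1 = n + 1) a = 0 ∧
          ∃ c, M.d (sub_add_cancel n 1) c = f.app n a - b := by
  constructor
  · intro h b hb
    obtain ⟨x, hx⟩ := h (Submodule.Quotient.mk ⟨b, hb⟩)
    induction x using Submodule.Quotient.induction_on with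
    | H a => exact ⟨a.1, a.2, (Submodule.Quotient.eq _).1 hx⟩
  · intro h x
    induction x using Submodule.Quotient.induction_on with
    | H b =>
      obtain ⟨a, ha, hc⟩ := h b.1 b.2
      exact ⟨Submodule.Quotient.mk ⟨a, ha⟩, (Submodule.Quotient.eq _).2 hc⟩

/-! ### Polynomial forms: constants and the Poincaré lemma -/

section
variable (L : DGLA.{u, w} K)

/-- The inclusion of constant forms `L → L[t, dt]`. -/
noncomputable def constHom : Hom L L.polyForms where
  app i := LinearMap.inl K (K[X] ⊗[K] L i) (K[X] ⊗[K] L (i - 1)) ∘ₗ TensorProduct.mk K K[X] (L i) 1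
  app_d {i j} h a := by
    refine Prod.ext rfl ?_
    change 0 = L.polyDeriv _ (1 ⊗ₜ a) - L.polyD (show i - 1 + 1 = j - 1 by omega) 0
    simp
  app_br {i j k} h a b := by
    refine Prod.ext ?_ ?_
    · change 1 ⊗ₜ[K] _ = L.polyBr h (1 ⊗ₜ a) (1 ⊗ₜ b)
      simp
    · change 0 = L.polyBr _ 0 (1 ⊗ₜ b) + i.negOnePow • L.polyBr _ (1 ⊗ₜ a) 0
      simp

theorem evalHom_constHom (s : K) {i : ℤ} (a : L i) :
    (L.evalHom s).app i (L.constHom.app i a) = a := by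
  change L.polyEval s i (1 ⊗ₜ a) = a
  simp

/-- The linear path `t ⊗ a` from `0` to `a`. -/
noncomputable def linearPath {i : ℤ} (a : L i) : L.polyForms i :=
  (Polynomial.X ⊗ₜ a, 0)

@[simp] theorem evalHom_zero_linearPath {i : ℤ} (a : L i) :
    (L.evalHom 0).app i (L.linearPath a) = 0 := by
  change L.polyEval 0 i (Polynomial.X ⊗ₜ a) = 0
  simp

@[simp] theorem evalHom_one_linearPath {i : ℤ} (a : L i) :
    (L.evalHom 1).app i (L.linearPath a) = a := by
  change L.polyEval 1 i (Polynomial.X ⊗ₜ a) = a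
  simp

theorem exists_path {i : ℤ} (a b : L i) :
    ∃ e, (L.evalHom 0).app i e = a ∧ (L.evalHom 1).app i e = b :=
  ⟨L.constHom.app i a + L.linearPath (b - a), by simp [evalHom_constHom],
    by simp [evalHom_constHom]⟩

/-- The form `dt ⊗ a`. -/
noncomputable def dtForm {i j : ℤ} (h : i + 1 = j) : L i →ₗ[K] L.polyForms j :=
  LinearMap.inr K (K[X] ⊗[K] L j) (K[X] ⊗[K] L (j - 1)) ∘ₗ TensorProduct.mk K K[X] (L (j - 1)) 1 ∘ₗ
    (L.castDeg (by omega)).toLinearMap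

theorem evalHom_dtForm (s : K) {i j : ℤ} (h : i + 1 = j) (a : L i) :
    (L.evalHom s).app j (L.dtForm h a) = 0 :=
  map_zero (L.polyEval s j)

theorem castDeg_d {i j i' j' : ℤ} (hi : i = i') (hj : j = j') (h : i + 1 = j) (h' : i' + 1 = j')
    (a : L i) : L.castDeg hj (L.d h a) = L.d h' (L.castDeg hi a) := by
  subst hi hj
  rfl

theorem d_dtForm {i j k : ℤ} (h : i + 1 = j) (h' : j + 1 = k) (a : L i) :
    L.polyForms.d h' (L.dtForm h a) = -L.dtForm h' (L.d h a) := by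
  refine Prod.ext ?_ ?_
  · change L.polyD h' 0 = -0
    simp
  · change L.polyDeriv (show j = k - 1 by omega) 0 - L.polyD _ (1 ⊗ₜ L.castDeg _ a) =
      -(1 ⊗ₜ L.castDeg _ (L.d h a))
    rw [L.castDeg_d (i' := j - 1) (j' := k - 1) (by omega) (by omega) h (by omega)]
    simp

theorem br_dtForm {i j i' j' k : ℤ} (h : i + 1 = j) (h' : i' + 1 = j') (hk : j + j' = k)
    (a : L i) (b : L i') : L.polyForms.br hk (L.dtForm h a) (L.dtForm h' b) = 0 := by
  refine Prod.ext ?_ ?_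
  · change L.polyBr hk 0 0 = 0
    simp
  · change L.polyBr _ _ 0 + _ • L.polyBr _ 0 _ = 0
    simp

theorem d_linearPath {i j : ℤ} (h : i + 1 = j) {a : L i} (ha : L.d h a = 0) :
    L.polyForms.d h (L.linearPath a) = L.dtForm h a := by
  refine Prod.ext ?_ ?_
  · change L.polyD h (Polynomial.X ⊗ₜ a) = 0
    simp [ha]
  · change L.polyDeriv _ (Polynomial.X ⊗ₜ a) - L.polyD (show i - 1 + 1 = j - 1 by omega) 0 =
      1 ⊗ₜ L.castDeg _ a
    simp

end

/-- The primitive with zero constant term, `t ^ n ↦ t ^ (n + 1) / (n + 1)`. -/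
noncomputable def primitive (K : Type u) [Field K] : K[X] →ₗ[K] K[X] :=
  Polynomial.lsum fun n => ((n + 1 : K)⁻¹) • Polynomial.monomial (n + 1)

theorem primitive_monomial (n : ℕ) (a : K) :
    primitive K (Polynomial.monomial n a) = Polynomial.monomial (n + 1) ((n + 1 : K)⁻¹ * a) := by
  simp [primitive, Polynomial.lsum, Polynomial.smul_monomial]

theorem derivative_primitive [CharZero K] (p : K[X]) :
    Polynomial.derivative (primitive K p) = p := by
  induction p using Polynomial.induction_on' with
  | add p q hp hq => simp [hp, hq]
  | monomial n a =>
    have : (n + 1 : K) ≠ 0 := by exact_mod_cast n.succ_ne_zero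
    rw [primitive_monomial, Polynomial.derivative_monomial]
    simp only [add_tsub_cancel_right]
    congr 1
    push_cast
    field_simp

theorem primitive_derivative [CharZero K] (p : K[X]) :
    primitive K (Polynomial.derivative p) = p - Polynomial.C (p.eval 0) := by
  induction p using Polynomial.induction_on' with
  | add p q hp hq => simp [hp, hq]; ring
  | monomial n a =>
    rw [Polynomial.derivative_monomial, primitive_monomial]
    rcases n with _ | n
    · simp
    · have : (n + 1 : K) ≠ 0 := by exact_mod_cast n.succ_ne_zero
      simp only [add_tsub_cancel_right, Polynomial.eval_monomial]
      simp
      field_simp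

theorem eval_zero_primitive (p : K[X]) : (primitive K p).eval 0 = 0 := by
  induction p using Polynomial.induction_on' with
  | add p q hp hq => simp [hp, hq]
  | monomial n a => simp [primitive_monomial]

section
variable (L : DGLA.{u, w} K)

/-- Integration from `0` in `t`: `p ⊗ a ↦ (∫₀ᵗ p) ⊗ a`. -/
noncomputable def polyPrimitive {i j : ℤ} (h : i = j) :
    K[X] ⊗[K] L i →ₗ[K] K[X] ⊗[K] L j :=
  TensorProduct.map (primitive K) (L.castDeg h).toLinearMap

theorem polyDeriv_polyPrimitive [CharZero K] {i j : ℤ} (h : i = j) (h' : j = i)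
    (x : K[X] ⊗[K] L i) : L.polyDeriv h' (L.polyPrimitive h x) = x := by
  subst h
  induction x with
  | zero => simp
  | add x y hx hy => simp [hx, hy]
  | tmul p a => simp [polyPrimitive, derivative_primitive]

theorem polyPrimitive_polyDeriv [CharZero K] {i j : ℤ} (h : i = j) (h' : j = i)
    (x : K[X] ⊗[K] L i) :
    L.polyPrimitive h' (L.polyDeriv h x) = x - 1 ⊗ₜ L.polyEval 0 i x := by
  subst h
  induction x with
  | zero => simp
  | add x y hx hy => simp only [map_add, hx, hy, TensorProduct.tmul_add]; abel
  | tmul p a =>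
    simp only [polyPrimitive, polyDeriv_tmul, TensorProduct.map_tmul, primitive_derivative,
      polyEval_tmul, TensorProduct.sub_tmul, castDeg_rfl, LinearEquiv.coe_coe]
    rw [← TensorProduct.smul_tmul, Polynomial.smul_eq_C_mul, mul_one]

theorem polyD_polyPrimitive {i i' j j' : ℤ} (hi : i = i') (hj : j = j') (h : i + 1 = j)
    (h' : i' + 1 = j') (x : K[X] ⊗[K] L i) :
    L.polyD h' (L.polyPrimitive hi x) = L.polyPrimitive hj (L.polyD h x) := by
  subst hi hj
  induction x with
  | zero => simp
  | add x y hx hy => simp [hx, hy]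
  | tmul p a => simp [polyPrimitive]

theorem polyEval_zero_polyPrimitive {i j : ℤ} (h : i = j) (x : K[X] ⊗[K] L i) :
    L.polyEval 0 j (L.polyPrimitive h x) = 0 := by
  subst h
  induction x with
  | zero => simp
  | add x y hx hy => simp [hx, hy]
  | tmul p a => simp [polyPrimitive, eval_zero_primitive]

/-- The Poincaré lemma: a closed polynomial form vanishing at `0` has a primitive vanishing at
`0`, namely `∫₀ᵗ`. -/
theorem exists_primitive [CharZero K] {i j k : ℤ} (h : i + 1 = j) (h' : j + 1 = k)
    (e : L.polyForms j) (he : L.polyForms.d h' e = 0) (he₀ : (L.evalHom 0).app j e = 0) :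
    ∃ v, L.polyForms.d h v = e ∧ (L.evalHom 0).app i v = 0 := by
  obtain ⟨x, y⟩ := e
  replace he₀ : L.polyEval 0 j x = 0 := he₀
  have he' : L.polyDeriv (by omega) x - L.polyD (by omega) y = (0 : K[X] ⊗[K] L (k - 1)) :=
    congrArg Prod.snd he
  refine ⟨(L.polyPrimitive (by omega) y, 0), Prod.ext ?_ ?_,
    L.polyEval_zero_polyPrimitive (by omega) y⟩
  · change L.polyD h (L.polyPrimitive _ y) = x
    rw [L.polyD_polyPrimitive (j := k - 1) (by omega) (by omega) (by omega), ← sub_eq_zero.1 he',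
      polyPrimitive_polyDeriv, he₀]
    simp
  · change L.polyDeriv _ (L.polyPrimitive _ y) - L.polyD (show i - 1 + 1 = j - 1 by omega) 0 = y
    rw [polyDeriv_polyPrimitive, map_zero, sub_zero]

/-- The end points of a closed polynomial form are cohomologous. -/
theorem exists_d_eq_sub [CharZero K] {i j k : ℤ} (h : i + 1 = j) (h' : j + 1 = k)
    (e : L.polyForms j) (he : L.polyForms.d h' e = 0) :
    ∃ v, L.d h v = (L.evalHom 1).app j e - (L.evalHom 0).app j e := by
  obtain ⟨v, hv, -⟩ := L.exists_primitive h h' (e - L.constHom.app j ((L.evalHom 0).app j e))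
    (by rw [map_sub, he, ← Hom.app_d, ← Hom.app_d, he, map_zero, map_zero, sub_zero])
    (by rw [map_sub, evalHom_constHom, sub_self])
  refine ⟨(L.evalHom 1).app i v, ?_⟩
  rw [← Hom.app_d, hv, map_sub, evalHom_constHom]

end

/-! ### Homotopy pullbacks -/

section
universe v₁ v₂ v₃
variable {X : DGLA.{u, v₁} K} {Y : DGLA.{u, v₂} K} {E : DGLA.{u, v₃} K}

/-- The homotopy pullback `{(x, y, e(t)) ∈ X × Y × E[t, dt] | e(0) = φ x, e(1) = ψ y}` of
`φ : X → E` and `ψ : Y → E`, as a subalgebra of `(X × Y) × E[t, dt]`. -/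
noncomputable def homotopyPullbackSub (φ : Hom X E) (ψ : Hom Y E) :
    ((X.prod Y).prod E.polyForms).Sub where
  carrier i :=
    LinearMap.eqLocus ((E.evalHom 0).app i ∘ₗ LinearMap.snd K (X i × Y i) (E.polyForms i))
        (φ.app i ∘ₗ LinearMap.fst K (X i) (Y i) ∘ₗ
          LinearMap.fst K (X i × Y i) (E.polyForms i)) ⊓
      LinearMap.eqLocus ((E.evalHom 1).app i ∘ₗ LinearMap.snd K (X i × Y i) (E.polyForms i))
        (ψ.app i ∘ₗ LinearMap.snd K (X i) (Y i) ∘ₗ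
          LinearMap.fst K (X i × Y i) (E.polyForms i))
  d_mem {i j} h {a} ha := by
    obtain ⟨h0, h1⟩ := ha
    change (E.evalHom 0).app i a.2 = φ.app i a.1.1 at h0
    change (E.evalHom 1).app i a.2 = ψ.app i a.1.2 at h1
    constructor
    · change (E.evalHom 0).app j (E.polyForms.d h a.2) = φ.app j (X.d h a.1.1)
      rw [Hom.app_d, h0, Hom.app_d]
    · change (E.evalHom 1).app j (E.polyForms.d h a.2) = ψ.app j (Y.d h a.1.2)
      rw [Hom.app_d, h1, Hom.app_d]
  br_mem {i j k} h {a b} ha hb := by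
    obtain ⟨h0, h1⟩ := ha
    obtain ⟨h0', h1'⟩ := hb
    change (E.evalHom 0).app i a.2 = φ.app i a.1.1 at h0
    change (E.evalHom 1).app i a.2 = ψ.app i a.1.2 at h1
    change (E.evalHom 0).app j b.2 = φ.app j b.1.1 at h0'
    change (E.evalHom 1).app j b.2 = ψ.app j b.1.2 at h1'
    constructor
    · change (E.evalHom 0).app k (E.polyForms.br h a.2 b.2) = φ.app k (X.br h a.1.1 b.1.1)
      rw [Hom.app_br, h0, h0', Hom.app_br]
    · change (E.evalHom 1).app k (E.polyForms.br h a.2 b.2) = ψ.app k (Y.br h a.1.2 b.1.2)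
      rw [Hom.app_br, h1, h1', Hom.app_br]

/-- The homotopy pullback of `φ : X → E` and `ψ : Y → E`. -/
noncomputable def homotopyPullback (φ : Hom X E) (ψ : Hom Y E) : DGLA.{u, max u v₁ v₂ v₃} K :=
  (homotopyPullbackSub φ ψ).toDGLA

namespace homotopyPullback

variable (φ : Hom X E) (ψ : Hom Y E)

/-- Elements of the homotopy pullback from their three components. -/
def mk {i : ℤ} (x : X i) (y : Y i) (e : E.polyForms i) (h₀ : (E.evalHom 0).app i e = φ.app i x)
    (h₁ : (E.evalHom 1).app i e = ψ.app i y) : homotopyPullback φ ψ i :=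
  ⟨((x, y), e), h₀, h₁⟩

variable {φ ψ}

theorem eval_zero {i : ℤ} (p : homotopyPullback φ ψ i) :
    (E.evalHom 0).app i p.1.2 = φ.app i p.1.1.1 := p.2.1

theorem eval_one {i : ℤ} (p : homotopyPullback φ ψ i) :
    (E.evalHom 1).app i p.1.2 = ψ.app i p.1.1.2 := p.2.2

theorem ext {i : ℤ} {p q : homotopyPullback φ ψ i} (h₁ : p.1.1.1 = q.1.1.1)
    (h₂ : p.1.1.2 = q.1.1.2) (h₃ : p.1.2 = q.1.2) : p = q :=
  Subtype.ext (Prod.ext (Prod.ext h₁ h₂) h₃)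

variable (φ ψ)

/-- The first projection of a homotopy pullback. -/
noncomputable def fst : Hom (homotopyPullback φ ψ) X where
  app i := LinearMap.fst K (X i) (Y i) ∘ₗ LinearMap.fst K (X i × Y i) (E.polyForms i) ∘ₗ
    ((homotopyPullbackSub φ ψ).carrier i).subtype
  app_d _ _ := rfl
  app_br _ _ _ := rfl

/-- The second projection of a homotopy pullback. -/
noncomputable def snd : Hom (homotopyPullback φ ψ) Y where
  app i := LinearMap.snd K (X i) (Y i) ∘ₗ LinearMap.fst K (X i × Y i) (E.polyForms i) ∘ₗ
    ((homotopyPullbackSub φ ψ).carrier i).subtype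
  app_d _ _ := rfl
  app_br _ _ _ := rfl

/-- The projection of a homotopy pullback opposite to a quasi-isomorphism is one. -/
theorem isQuasiIso_fst [CharZero K] (hψ : ψ.IsQuasiIso) : (fst φ ψ).IsQuasiIso := by
  intro n
  have hinj {m : ℤ} := (ψ.injective_cohomologyMap_iff m).1 (hψ m).1
  have hsurj {m : ℤ} := (ψ.surjective_cohomologyMap_iff m).1 (hψ m).2
  constructor
  · rw [Hom.injective_cohomologyMap_iff]
    rintro p hp ⟨x', hx'⟩
    change X.d _ x' = p.1.1.1 at hx'
    have hy : Y.d rfl p.1.1.2 = 0 := congrArg (fun q => q.1.1.2) hp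
    have he : E.polyForms.d rfl p.1.2 = 0 := congrArg (fun q => q.1.2) hp
    obtain ⟨v, hv⟩ := E.exists_d_eq_sub (sub_add_cancel n 1) rfl p.1.2 he
    obtain ⟨y₁, hy₁⟩ := hinj p.1.1.2 hy ⟨v + φ.app _ x', by
      rw [map_add, hv, eval_zero, eval_one, ← φ.app_d, hx', sub_add_cancel]⟩
    obtain ⟨e₁, he₁, he₁'⟩ := E.exists_path (φ.app _ x') (ψ.app _ y₁)
    -- `p.1.2 - d e₁` is closed and vanishes at both ends; the value at `1` of its primitive is
    -- the remaining obstruction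
    obtain ⟨z, hz, hz₀⟩ := E.exists_primitive (sub_add_cancel n 1) rfl
      (p.1.2 - E.polyForms.d (sub_add_cancel n 1) e₁)
      (by rw [map_sub, he, d_d, sub_zero])
      (by rw [map_sub, eval_zero, Hom.app_d, he₁, ← φ.app_d, hx', sub_self])
    have hz₁ : E.d (sub_add_cancel n 1) ((E.evalHom 1).app _ z) = 0 := by
      rw [← Hom.app_d, hz, map_sub, eval_one, Hom.app_d, he₁', ← ψ.app_d, hy₁, sub_self]
    obtain ⟨y₂, hy₂, c, hc⟩ := hsurj _ (E.d_eq_zero_of_eq _ hz₁)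
    obtain ⟨e₂, he₂, he₂'⟩ := E.exists_path 0 c
    refine ⟨mk φ ψ x' (y₁ + y₂) (e₁ + z + E.polyForms.d (sub_add_cancel (n - 1) 1) e₂) ?_ ?_, ?_⟩
    · rw [map_add, map_add, Hom.app_d, he₁, hz₀, he₂]
      simp
    · rw [map_add, map_add, Hom.app_d, he₁', he₂', hc, map_add]
      abel
    · refine ext hx' ?_ ?_
      · change Y.d _ (y₁ + y₂) = _
        rw [map_add, hy₁, Y.d_eq_zero_of_eq _ hy₂, add_zero]
      · change E.polyForms.d _ (e₁ + z + _) = _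
        rw [map_add, map_add, d_d, hz]
        abel
  · rw [Hom.surjective_cohomologyMap_iff]
    intro x hx
    obtain ⟨y, hy, c, hc⟩ := hsurj (φ.app n x) (by rw [← φ.app_d, hx, map_zero])
    obtain ⟨e, he, he'⟩ := E.exists_path 0 c
    refine ⟨mk φ ψ x y (E.constHom.app n (φ.app n x) + E.polyForms.d (sub_add_cancel n 1) e) ?_ ?_,
      ?_, 0, ?_⟩
    · rw [map_add, evalHom_constHom, Hom.app_d, he]
      simp
    · rw [map_add, evalHom_constHom, Hom.app_d, he', hc]
      abel
    · refine ext hx hy ?_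
      change E.polyForms.d _ (E.constHom.app n (φ.app n x) + E.polyForms.d _ e) = 0
      rw [map_add, d_d, ← Hom.app_d, ← φ.app_d, hx]
      simp
    · change X.d _ 0 = x - x
      simp

/-- The morphism to a homotopy pullback, with constant path, induced by a commutative square. -/
noncomputable def lift {L : DGLA.{u, w} K} (f : Hom L X) (g : Hom L Y)
    (hfg : ∀ (i : ℤ) (a : L i), φ.app i (f.app i a) = ψ.app i (g.app i a)) :
    Hom L (homotopyPullback φ ψ) where
  app i := (LinearMap.prod (LinearMap.prod (f.app i) (g.app i))
      (E.constHom.app i ∘ₗ φ.app i ∘ₗ f.app i)).codRestrict ((homotopyPullbackSub φ ψ).carrier i)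
    (fun a => ⟨E.evalHom_constHom 0 _, (E.evalHom_constHom 1 _).trans (hfg i a)⟩)
  app_d h a := ext (f.app_d h a) (g.app_d h a) (by
    change E.constHom.app _ (φ.app _ (f.app _ _)) = E.polyForms.d h (E.constHom.app _ _)
    rw [f.app_d, φ.app_d, Hom.app_d]
    rfl)
  app_br h a b := ext (f.app_br h a b) (g.app_br h a b) (by
    change E.constHom.app _ (φ.app _ (f.app _ _)) =
      E.polyForms.br h (E.constHom.app _ (φ.app _ (f.app _ a))) (E.constHom.app _ _)
    rw [f.app_br, φ.app_br, Hom.app_br]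
    rfl)

end homotopyPullback

end

/-! ### Detecting homotopy abelian algebras -/

/-- A graded vector space with zero differential and zero bracket. -/
def ofGraded (V : ℤ → Type w) [∀ i, AddCommGroup (V i)] [∀ i, Module K (V i)] : DGLA.{u, w} K where
  comp := V
  d _ := 0
  br _ := 0
  d_d _ _ _ := rfl
  br_antisymm _ _ _ _ := by simp
  leibniz _ _ _ _ := by simp
  jacobi _ _ _ _ := by simp

/-- It is enough to find a morphism that is injective in cohomology from a model of `L` to a DGLA
with zero bracket: over a field, such a morphism can be followed by a retraction onto the
cohomology of the model. -/
theorem IsHomotopyAbelian.of_injective {L : DGLA.{u, w} K} {N : DGLA.{u, max u w} K}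
    {A : DGLA.{u, w'} K} (f : Hom N L) (hf : f.IsQuasiIso) (g : Hom N A)
    (hg : ∀ n, Function.Injective (g.cohomologyMap n)) (hA : A.IsAbelian) :
    L.IsHomotopyAbelian := by
  have key (n : ℤ) : ∃ r : A n →ₗ[K] N.cohomology n,
      (∀ a : N.cocycles n, r (g.app n a.1) = Submodule.Quotient.mk a) ∧
        ∀ x, r (A.d (sub_add_cancel n 1) x) = 0 := by
    obtain ⟨l, hl⟩ := (g.cohomologyMap n).exists_leftInverse_of_injective
      (LinearMap.ker_eq_bot.2 (hg n))
    obtain ⟨r, hr⟩ := (l ∘ₗ ((A.coboundaries n).submoduleOf (A.cocycles n)).mkQ).exists_extend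
    refine ⟨r, fun a => ?_, fun x => ?_⟩
    · exact (LinearMap.congr_fun hr (g.cocyclesMap n a)).trans
        (LinearMap.congr_fun hl (Submodule.Quotient.mk a))
    · refine (LinearMap.congr_fun hr ⟨A.d (sub_add_cancel n 1) x, A.d_d _ _ x⟩).trans ?_
      refine (congrArg l ((Submodule.Quotient.mk_eq_zero _).2 ?_)).trans (map_zero l)
      exact ⟨x, rfl⟩
  choose r hr hr' using key
  let G : Hom N (ofGraded N.cohomology) :=
    { app := fun n => r n ∘ₗ g.app n
      app_d := fun {i j} h a => by
        obtain rfl : i = j - 1 := by omega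
        change r j (g.app j (N.d _ a)) = 0
        rw [g.app_d, hr']
      app_br := fun {i j k} h a b => by
        change r k (g.app k (N.br _ a b)) = 0
        rw [g.app_br, hA, map_zero] }
  refine ⟨N, ofGraded N.cohomology, f, G, hf, fun n => ⟨?_, ?_⟩, fun _ _ _ => rfl⟩
  · rw [Hom.injective_cohomologyMap_iff]
    rintro a ha ⟨b, hb⟩
    exact (Submodule.Quotient.mk_eq_zero _).1 ((hr n ⟨a, ha⟩).symm.trans hb.symm)
  · rw [Hom.surjective_cohomologyMap_iff]
    intro x _
    induction x using Submodule.Quotient.induction_on with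
    | H a =>
      refine ⟨a.1, a.2, 0, ?_⟩
      change 0 = r n (g.app n a.1) - _
      rw [hr, sub_self]

/-! ### The axioms with independent indices -/

section
variable (L : DGLA.{u, w} K)

theorem leibniz_of {i j k n i' j' : ℤ} (hij : i + j = k) (hk : k + 1 = n) (hi : i + 1 = i')
    (hj : j + 1 = j') (h₁ : i' + j = n) (h₂ : i + j' = n) (a : L i) (b : L j) :
    L.d hk (L.br hij a b) = L.br h₁ (L.d hi a) b + i.negOnePow • L.br h₂ a (L.d hj b) := by
  subst hi hj
  exact L.leibniz hij hk a b

theorem jacobi_of {i j k n ij jk ki : ℤ} (hij : i + j = ij) (hjk : j + k = jk) (hki : k + i = ki)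
    (h₁ : ij + k = n) (h₂ : jk + i = n) (h₃ : ki + j = n) (a : L i) (b : L j) (c : L k) :
    L.br h₁ (L.br hij a b) c + (i * (j + k)).negOnePow • L.br h₂ (L.br hjk b c) a +
      (k * (i + j)).negOnePow • L.br h₃ (L.br hki c a) b = 0 := by
  subst hij hjk hki
  exact L.jacobi (by omega) a b c

theorem castDeg_br {i j k k' : ℤ} (e : k = k') (h : i + j = k) (h' : i + j = k') (a : L i)
    (b : L j) : L.castDeg e (L.br h a b) = L.br h' a b := by
  subst e
  rfl

theorem d_castDeg {i i' j : ℤ} (e : i = i') (h : i' + 1 = j) (h' : i + 1 = j) (a : L i) :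
    L.d h (L.castDeg e a) = L.d h' a := by
  subst e
  rfl

theorem castDeg_d' {i j j' : ℤ} (e : j = j') (h : i + 1 = j) (h' : i + 1 = j') (a : L i) :
    L.castDeg e (L.d h a) = L.d h' a := by
  subst e
  rfl

/-! ### The cone of the identity -/

/-- The bracket of the cone of the identity. -/
def coneBr {i j k : ℤ} (h : i + j = k) :
    (L i × L (i + 1)) →ₗ[K] (L j × L (j + 1)) →ₗ[K] (L k × L (k + 1)) :=
  LinearMap.mk₂ K
    (fun x y => (L.br h x.1 y.1,
      i.negOnePow • L.br (by omega) x.1 y.2 + L.br (by omega) x.2 y.1))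
    (fun _ _ _ => Prod.ext (by simp) (by simp; abel))
    (fun _ _ _ => Prod.ext (by simp) (by simp [smul_comm i.negOnePow]))
    (fun _ _ _ => Prod.ext (by simp) (by simp; abel))
    (fun _ _ _ => Prod.ext (by simp) (by simp [smul_comm i.negOnePow]))

/-- The differential of the cone of the identity. -/
def coneD {i j : ℤ} (h : i + 1 = j) : (L i × L (i + 1)) →ₗ[K] (L j × L (j + 1)) :=
  LinearMap.prod (L.d h ∘ₗ LinearMap.fst K _ _ + (L.castDeg h).toLinearMap ∘ₗ LinearMap.snd K _ _)
    (-(L.d (by omega) ∘ₗ LinearMap.snd K _ _))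

theorem coneBr_apply {i j k : ℤ} (h : i + j = k) (x : L i × L (i + 1)) (y : L j × L (j + 1)) :
    L.coneBr h x y = (L.br h x.1 y.1,
      i.negOnePow • L.br (by omega) x.1 y.2 + L.br (by omega) x.2 y.1) := rfl

theorem coneD_apply {i j : ℤ} (h : i + 1 = j) (x : L i × L (i + 1)) :
    L.coneD h x = (L.d h x.1 + L.castDeg h x.2, -L.d (by omega) x.2) := rfl

/-- The cone of the identity of `L`, that is `L ⊗ K[ε]` with `ε` of degree `-1`, `ε² = 0` and
`dε = 1`. A pair `(a, b)` stands for `a + ε b`, with the sign convention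
`[a, ε b] = (-1)^{|a|} ε [a, b]`. -/
def cone : DGLA.{u, w} K where
  comp i := L i × L (i + 1)
  d h := L.coneD h
  br h := L.coneBr h
  d_d {i j k} hij hjk x := by
    refine Prod.ext ?_ ?_
    · simp only [coneD_apply, map_add, map_neg, L.d_d, Prod.fst_zero]
      rw [L.d_castDeg hij hjk (by omega), L.castDeg_d' (j' := k) (by omega) _ (by omega)]
      simp
    · simp [coneD_apply, L.d_d]
  br_antisymm {i j k} hij hji x y := by
    refine Prod.ext (L.br_antisymm hij hji x.1 y.1) ?_
    simp only [coneBr_apply, Prod.snd_neg, Prod.smul_snd]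
    rw [L.br_antisymm (i := i) (j := j + 1) (by omega) (by omega) x.1 y.2,
      L.br_antisymm (i := i + 1) (j := j) (by omega) (by omega) x.2 y.1]
    rcases Int.even_or_odd i with hi | hi <;> rcases Int.even_or_odd j with hj | hj <;>
    simp [Int.negOnePow_add, Int.negOnePow_even, Int.negOnePow_odd, hi, hj, mul_add, add_mul]
  leibniz {i j k n} hij hk x y := by
    refine Prod.ext ?_ ?_
    · simp only [coneBr_apply, coneD_apply, Prod.fst_add, Prod.smul_fst, map_add,
        LinearMap.add_apply, smul_add]
      rw [L.leibniz hij hk, castDeg_rfl, castDeg_rfl]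
      have h₁ : L.castDeg hk (i.negOnePow • L.br (show i + (j + 1) = k + 1 by omega) x.1 y.2) =
          i.negOnePow • L.br (by omega) x.1 y.2 := by
        subst hk
        rfl
      rw [h₁, L.castDeg_br hk _ (by omega)]
      abel
    · simp only [coneBr_apply, coneD_apply, Prod.snd_add, Prod.smul_snd, map_add, map_neg,
        LinearMap.add_apply, LinearMap.neg_apply, smul_add, castDeg_rfl]
      rw [L.leibniz_of (i' := i + 1 + 1) (j' := j + 1) (show i + 1 + j = k + 1 by omega) (by omega)
        rfl rfl (by omega) (by omega)]
      have h₁ : L.d (show k + 1 + 1 = n + 1 by omega)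
            (i.negOnePow • L.br (show i + (j + 1) = k + 1 by omega) x.1 y.2) =
          i.negOnePow • (L.br (show i + 1 + (j + 1) = n + 1 by omega) (L.d rfl x.1) y.2 +
            i.negOnePow • L.br (by omega) x.1 (L.d rfl y.2)) := by
        rw [← L.leibniz_of (show i + (j + 1) = k + 1 by omega) (show k + 1 + 1 = n + 1 by omega)]
        rcases Int.even_or_odd i with hi | hi <;>
          simp [Int.negOnePow_even, Int.negOnePow_odd, hi]
      rw [h₁]
      rcases Int.even_or_odd i with hi | hi <;>
        simp [Int.negOnePow_even, Int.negOnePow_odd, hi, hi.add_one] <;> abel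
  jacobi {i j k n} h x y z := by
    refine Prod.ext (L.jacobi h x.1 y.1 z.1) ?_
    have h₁ := L.jacobi_of (n := n + 1) (ij := i + j + 1) (jk := j + k) (ki := k + i + 1)
      (by omega) (by omega) (by omega) (by omega) (by omega) (by omega) x.2 y.1 z.1
    have h₂ := L.jacobi_of (n := n + 1) (ij := i + j + 1) (jk := j + k + 1) (ki := k + i)
      (by omega) (by omega) (by omega) (by omega) (by omega) (by omega) x.1 y.2 z.1
    have h₃ := L.jacobi_of (n := n + 1) (ij := i + j) (jk := j + k + 1) (ki := k + i + 1)
      (by omega) (by omega) (by omega) (by omega) (by omega) (by omega) x.1 y.1 z.2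
    have key := congrArg₂ (· + ·) (congrArg₂ (· + ·) h₁
      (congrArg (i.negOnePow • ·) h₂)) (congrArg ((i + j).negOnePow • ·) h₃)
    simp only [add_zero, smul_zero] at key
    rw [Prod.snd_zero, ← key]
    simp only [coneBr_apply, Prod.snd_add, Prod.smul_snd, map_add, smul_add,
      LinearMap.add_apply]
    rcases Int.even_or_odd i with hi | hi <;> rcases Int.even_or_odd j with hj | hj <;>
    rcases Int.even_or_odd k with hk | hk <;>
    simp [Int.negOnePow_add, Int.negOnePow_even, Int.negOnePow_odd, hi, hj, hk,
      Int.even_mul, Int.even_add, Int.odd_add, mul_add, add_mul] <;> abel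

/-- The inclusion of `L` in the cone of its identity. -/
def toCone : Hom L L.cone where
  app i := LinearMap.inl K (L i) (L (i + 1))
  app_d {i j} h a := by
    refine Prod.ext ?_ ?_
    · change L.d h a = L.d h a + L.castDeg h 0
      simp
    · change 0 = -L.d _ 0
      simp
  app_br {i j k} h a b := by
    refine Prod.ext rfl ?_
    change 0 = i.negOnePow • L.br _ a 0 + L.br _ 0 b
    simp

/-- The cone of the identity is acyclic: `d (ε a) = a` for `a` closed. -/
theorem exists_cone_d_eq {i j k : ℤ} (h : i + 1 = j) (h' : j + 1 = k) (x : L.cone j)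
    (hx : L.cone.d h' x = 0) : ∃ y, L.cone.d h y = x := by
  obtain ⟨a, b⟩ := x
  have h₁ : L.d h' a + L.castDeg h' b = 0 := congrArg Prod.fst hx
  refine ⟨(0, L.castDeg h.symm a), Prod.ext ?_ ?_⟩
  · change L.d h 0 + L.castDeg h (L.castDeg h.symm a) = a
    subst h
    simp
  · change -L.d _ (L.castDeg h.symm a) = b
    rw [L.d_castDeg h.symm _ rfl]
    subst h'
    exact neg_eq_of_add_eq_zero_right h₁

end

/-! ### Operators on a module with parity and differential -/

section
variable {W : Type w'} [AddCommGroup W] [Module K W]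

/-- The operators of parity `n` for the parity operator `P`. -/
def parityOperators (P : Module.End K W) (n : ℤ) : Submodule K (Module.End K W) where
  carrier := {f | P * f = n.negOnePow • (f * P)}
  zero_mem' := by simp
  add_mem' {f g} hf hg := by
    simp only [Set.mem_ofPred_eq] at hf hg ⊢
    rw [mul_add, add_mul, smul_add, hf, hg]
  smul_mem' c f hf := by
    simp only [Set.mem_ofPred_eq] at hf ⊢
    rw [mul_smul_comm, smul_mul_assoc, hf, smul_comm]

theorem mem_parityOperators {P : Module.End K W} {n : ℤ} {f : Module.End K W} :
    f ∈ parityOperators P n ↔ P * f = n.negOnePow • (f * P) := Iff.rfl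

theorem mul_mem_parityOperators {P : Module.End K W} {m n : ℤ} {f g : Module.End K W}
    (hf : f ∈ parityOperators P m) (hg : g ∈ parityOperators P n) :
    f * g ∈ parityOperators P (m + n) := by
  rw [mem_parityOperators] at hf hg ⊢
  rw [← mul_assoc, hf, smul_mul_assoc, mul_assoc, hg, mul_smul_comm, smul_smul,
    Int.negOnePow_add, mul_assoc]

theorem units_smul_mem (ε : ℤˣ) {S : Submodule K W} {x : W} (hx : x ∈ S) : ε • x ∈ S := by
  rcases Int.units_eq_one_or ε with rfl | rfl <;> simpa using hx

/-- The supercommutator of operators of parities `i` and `j`. -/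
def superBr (i j : ℤ) (f g : Module.End K W) : Module.End K W :=
  f * g - (i * j).negOnePow • (g * f)

theorem superBr_mem {P : Module.End K W} {i j k : ℤ} (h : i + j = k) {f g : Module.End K W}
    (hf : f ∈ parityOperators P i) (hg : g ∈ parityOperators P j) :
    superBr i j f g ∈ parityOperators P k := by
  subst h
  exact sub_mem (mul_mem_parityOperators hf hg)
    (units_smul_mem _ (add_comm i j ▸ mul_mem_parityOperators hg hf))

/-- The DGLA of operators on a module `W` with parity operator `P` and an odd operator `Q` of
square zero. The component of degree `n` consists of the operators of the parity of `n`, so that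
it is periodic of period two; the differential is the supercommutator with `Q`. -/
def operators (P Q : Module.End K W) (hPQ : P * Q = -(Q * P)) (hQ : Q * Q = 0) :
    DGLA.{u, w'} K where
  comp n := parityOperators P n
  d {i j} h := ((LinearMap.mulLeft K Q - i.negOnePow • LinearMap.mulRight K Q) :
      Module.End K W →ₗ[K] Module.End K W).restrict
    (fun f hf => by
      have := superBr_mem (P := P) (i := 1) (f := Q) ((add_comm 1 i).trans h)
        (by simpa [mem_parityOperators] using hPQ) hf
      simpa [superBr] using this)
  br {i j k} h := LinearMap.mk₂ K
    (fun (f : parityOperators P i) (g : parityOperators P j) =>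
      (⟨superBr i j f.1 g.1, superBr_mem h f.2 g.2⟩ : parityOperators P k))
    (fun _ _ _ => Subtype.ext (by simp [superBr, add_mul, mul_add]; abel))
    (fun _ _ _ => Subtype.ext (by simp [superBr, smul_sub, smul_comm (i * j).negOnePow]))
    (fun _ _ _ => Subtype.ext (by simp [superBr, add_mul, mul_add]; abel))
    (fun _ _ _ => Subtype.ext (by simp [superBr, smul_sub, smul_comm (i * j).negOnePow]))
  d_d {i j k} hij hjk f := Subtype.ext (by
    change Q * (Q * f.1 - i.negOnePow • (f.1 * Q)) -
      j.negOnePow • ((Q * f.1 - i.negOnePow • (f.1 * Q)) * Q) = 0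
    subst hij
    rw [mul_sub, sub_mul, ← mul_assoc, hQ, smul_mul_assoc, mul_assoc f.1, hQ, mul_smul_comm,
      Int.negOnePow_succ, mul_assoc]
    simp)
  br_antisymm {i j k} hij hji f g := Subtype.ext (by
    change superBr i j f.1 g.1 = -((i * j).negOnePow • superBr j i g.1 f.1)
    rw [superBr, superBr, mul_comm j i, smul_sub, smul_smul, Int.units_mul_self, one_smul]
    abel)
  leibniz {i j k n} hij hk f g := Subtype.ext (by
    change Q * superBr i j f.1 g.1 - k.negOnePow • (superBr i j f.1 g.1 * Q) =
      superBr (i + 1) j (Q * f.1 - i.negOnePow • (f.1 * Q)) g.1 +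
        i.negOnePow • superBr i (j + 1) f.1 (Q * g.1 - j.negOnePow • (g.1 * Q))
    subst hij
    rcases Int.even_or_odd i with hi | hi <;> rcases Int.even_or_odd j with hj | hj <;>
    simp [superBr, Int.negOnePow_add, Int.negOnePow_even, Int.negOnePow_odd, hi, hj, mul_add,
      add_mul, mul_sub, sub_mul, mul_assoc] <;> abel)
  jacobi {i j k n} h f g l := Subtype.ext (by
    change superBr (i + j) k (superBr i j f.1 g.1) l.1 +
      (i * (j + k)).negOnePow • superBr (j + k) i (superBr j k g.1 l.1) f.1 +
      (k * (i + j)).negOnePow • superBr (k + i) j (superBr k i l.1 f.1) g.1 = 0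
    rcases Int.even_or_odd i with hi | hi <;> rcases Int.even_or_odd j with hj | hj <;>
    rcases Int.even_or_odd k with hk | hk <;>
    simp [superBr, Int.negOnePow_add, Int.negOnePow_even, Int.negOnePow_odd, hi, hj, hk, mul_add,
      add_mul, mul_sub, sub_mul, mul_assoc] <;> abel)

/-- The shifted complex of a module with parity operator `P` and odd operator `Q` of square zero,
as a DGLA with zero bracket: the component of degree `n` consists of the elements of the parity
of `n + 1`, with the differential `-Q`. -/
def shiftedComplex (P Q : Module.End K W) (hPQ : P * Q = -(Q * P)) (hQ : Q * Q = 0) :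
    DGLA.{u, w'} K where
  comp n := (LinearMap.ker (P - (n + 1).negOnePow • (1 : Module.End K W)) : Submodule K W)
  d {i j} h := (-Q).restrict (fun x hx => by
    subst h
    simp only [LinearMap.mem_ker, LinearMap.sub_apply, sub_eq_zero] at hx ⊢
    replace hx : P x = (i + 1).negOnePow • x := hx
    change P (-Q x) = (i + 1 + 1).negOnePow • (-Q x)
    have h₁ : P (Q x) = - Q (P x) := LinearMap.congr_fun hPQ x
    rw [map_neg, h₁, hx, Int.negOnePow_succ (i + 1)]
    rcases Int.units_eq_one_or (i + 1).negOnePow with h | h <;> simp only [h] <;> simp)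
  br _ := 0
  d_d _ _ x := Subtype.ext (by
    change -Q (-Q x) = 0
    have : Q (Q x) = 0 := LinearMap.congr_fun hQ x
    rw [map_neg, this]
    simp)
  br_antisymm _ _ _ _ := by simp
  leibniz _ _ _ _ := by simp
  jacobi _ _ _ _ := by simp

end

/-! ### Cartan modules -/

/-- A supermodule `W` over the cone of the identity of `L`, with `a` acting by `ρ a` and `ε a` by
`ι a`, together with a closed vector `one` annihilated by `L` and a functional `aug` splitting off
`one`. Only the parity of the degrees is recorded, through the parity operator `P`. -/
structure CartanModule (L : DGLA.{u, w} K) (W : Type w') [AddCommGroup W] [Module K W] where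
  /-- The parity operator. -/
  P : Module.End K W
  /-- The differential. -/
  Q : Module.End K W
  /-- The cyclic vector. -/
  one : W
  /-- The augmentation. -/
  aug : W →ₗ[K] K
  /-- The contractions, of degree `-1`. -/
  ι : ∀ i, L i →ₗ[K] Module.End K W
  /-- The Lie derivatives, of degree `0`. -/
  ρ : ∀ i, L i →ₗ[K] Module.End K W
  P_mul_Q : P * Q = -(Q * P)
  Q_mul_Q : Q * Q = 0
  P_one : P one = one
  Q_one : Q one = 0
  aug_one : aug one = 1
  aug_P : ∀ x, aug (P x) = aug x
  aug_Q : ∀ x, aug (Q x) = 0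
  P_mul_ι : ∀ {i : ℤ} (a : L i), P * ι i a = (i + 1).negOnePow • (ι i a * P)
  /-- Cartan's formula. -/
  Q_mul_ι : ∀ {i j : ℤ} (h : i + 1 = j) (a : L i),
    Q * ι i a = ρ i a - ι j (L.d h a) + (i + 1).negOnePow • (ι i a * Q)
  ι_mul_ι : ∀ {i j : ℤ} (a : L i) (b : L j),
    ι i a * ι j b = ((i + 1) * (j + 1)).negOnePow • (ι j b * ι i a)
  ρ_mul_ι : ∀ {i j k : ℤ} (h : i + j = k) (a : L i) (b : L j),
    ρ i a * ι j b = i.negOnePow • ι k (L.br h a b) + (i * (j + 1)).negOnePow • (ι j b * ρ i a)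
  ρ_one : ∀ {i : ℤ} (a : L i), ρ i a one = 0

namespace CartanModule

variable {L : DGLA.{u, w} K} {W : Type w'} [AddCommGroup W] [Module K W] (C : CartanModule L W)

theorem ρ_eq {i j : ℤ} (h : i + 1 = j) (a : L i) :
    C.ρ i a = C.Q * C.ι i a + C.ι j (L.d h a) - (i + 1).negOnePow • (C.ι i a * C.Q) := by
  rw [C.Q_mul_ι h a]
  abel

theorem P_mul_ρ {i : ℤ} (a : L i) : C.P * C.ρ i a = i.negOnePow • (C.ρ i a * C.P) := by
  rw [C.ρ_eq rfl a]
  have h₁ := C.P_mul_ι a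
  have h₂ := C.P_mul_ι (L.d rfl a)
  have h₃ := C.P_mul_Q
  rw [mul_sub, mul_add, mul_smul_comm, ← mul_assoc, h₃, neg_mul, mul_assoc, h₁, h₂, mul_smul_comm,
    ← mul_assoc C.P (C.ι i a), h₁, smul_mul_assoc, mul_assoc (C.ι i a), h₃]
  rcases Int.even_or_odd i with hi | hi <;>
    simp [Int.negOnePow_even, Int.negOnePow_odd, hi, add_mul, sub_mul, mul_assoc]
  abel

theorem Q_mul_ρ {i j : ℤ} (h : i + 1 = j) (a : L i) :
    C.Q * C.ρ i a = C.ρ j (L.d h a) + i.negOnePow • (C.ρ i a * C.Q) := by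
  subst h
  have h₁ := C.Q_mul_ι rfl (L.d rfl a)
  rw [L.d_d, map_zero, sub_zero] at h₁
  have h₂ : ∀ x, C.Q * (C.Q * x) = 0 := fun x => by rw [← mul_assoc, C.Q_mul_Q, zero_mul]
  rw [C.ρ_eq rfl a, mul_sub, mul_add, h₁, mul_smul_comm]
  rcases Int.even_or_odd i with hi | hi <;>
    simp [Int.negOnePow_even, Int.negOnePow_odd, hi, add_mul, sub_mul, mul_assoc, h₂,
      C.Q_mul_Q] <;> abel

/-- The Lie derivatives represent `L`: this follows from Cartan's formula and the bracket of a Lie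
derivative with a contraction. -/
theorem ρ_mul_ρ {i j k : ℤ} (h : i + j = k) (a : L i) (b : L j) :
    C.ρ i a * C.ρ j b = C.ρ k (L.br h a b) + (i * j).negOnePow • (C.ρ j b * C.ρ i a) := by
  subst h
  have e₁ := C.ρ_mul_ι rfl a b
  have e₂ := C.ρ_mul_ι (k := i + j + 1) (by omega) a (L.d rfl b)
  have e₃ := C.ρ_mul_ι (k := i + j + 1) (by omega) (L.d rfl a) b
  have e₄ := C.ρ_eq rfl (L.br rfl a b)
  rw [L.leibniz_of (i' := i + 1) (j' := j + 1) rfl rfl rfl rfl (by omega) (by omega)] at e₄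
  have e₅ := C.Q_mul_ρ rfl a
  have e₆ : C.ρ i a * C.Q = i.negOnePow • (C.Q * C.ρ i a - C.ρ (i + 1) (L.d rfl a)) := by
    rw [e₅, add_sub_cancel_left, smul_smul, Int.units_mul_self, one_smul]
  have e₇ : C.ρ i a * (C.Q * C.ι j b) =
      i.negOnePow • (C.Q * (C.ρ i a * C.ι j b) - C.ρ (i + 1) (L.d rfl a) * C.ι j b) := by
    rw [← mul_assoc, e₆, smul_mul_assoc, sub_mul, mul_assoc]
  have e₈ : C.ρ i a * (C.ι j b * C.Q) = (C.ρ i a * C.ι j b) * C.Q := (mul_assoc _ _ _).symm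
  rw [C.ρ_eq rfl b, e₄, mul_sub, mul_add, mul_smul_comm, e₇, e₈, e₁, e₂, e₃]
  rcases Int.even_or_odd i with hi | hi <;> rcases Int.even_or_odd j with hj | hj <;>
    simp [Int.negOnePow_add, Int.negOnePow_even, Int.negOnePow_odd, hi, hj, add_mul, sub_mul,
      mul_add, mul_sub, mul_assoc, e₆] <;> abel

/-- The DGLA of operators on a Cartan module. -/
abbrev ops : DGLA.{u, w'} K := operators C.P C.Q C.P_mul_Q C.Q_mul_Q

/-- The action of the cone of the identity on a Cartan module. -/
def action : Hom L.cone C.ops where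
  app i := ((C.ρ i).coprod (C.ι (i + 1))).codRestrict (parityOperators C.P i) (fun x => by
    refine add_mem ?_ ?_
    · exact C.P_mul_ρ x.1
    · have := C.P_mul_ι x.2
      rwa [Int.negOnePow_add, Int.negOnePow_add, Int.negOnePow_one, mul_assoc, neg_one_mul, neg_neg,
        mul_one] at this)
  app_d {i j} h x := Subtype.ext (by
    obtain ⟨a, b⟩ := x
    change C.ρ j (L.d h a + L.castDeg h b) + C.ι (j + 1) (-L.d _ b) =
      C.Q * (C.ρ i a + C.ι (i + 1) b) - i.negOnePow • ((C.ρ i a + C.ι (i + 1) b) * C.Q)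
    subst h
    rw [mul_add, C.Q_mul_ρ rfl, C.Q_mul_ι rfl, add_mul, castDeg_rfl, map_add, map_neg,
      Int.negOnePow_succ, Int.negOnePow_succ, neg_neg, smul_add]
    abel)
  app_br {i j k} h x y := Subtype.ext (by
    obtain ⟨a, b⟩ := x
    obtain ⟨a', b'⟩ := y
    change C.ρ k (L.br h a a') + C.ι (k + 1) (i.negOnePow • L.br _ a b' + L.br _ b a') =
      superBr i j (C.ρ i a + C.ι (i + 1) b) (C.ρ j a' + C.ι (j + 1) b')
    rw [L.br_antisymm (j := j) (show i + 1 + j = k + 1 by omega)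
        (show j + (i + 1) = k + 1 by omega), superBr, mul_add, add_mul (C.ρ i a),
      add_mul (C.ρ i a), C.ρ_mul_ρ h, C.ι_mul_ι b b',
      add_mul (C.ρ j a'), mul_add (C.ρ j a'), mul_add (C.ι (j + 1) b'),
      C.ρ_mul_ι (show i + (j + 1) = k + 1 by omega),
      C.ρ_mul_ι (show j + (i + 1) = k + 1 by omega)]
    rcases Int.even_or_odd i with hi | hi <;> rcases Int.even_or_odd j with hj | hj <;>
    simp [Int.negOnePow_add, Int.negOnePow_even, Int.negOnePow_odd, hi, hj, add_mul, mul_add]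
      <;> abel)

/-- The operators annihilating the cyclic vector. -/
def annihilator : C.ops.Sub where
  carrier i := LinearMap.ker (LinearMap.applyₗ C.one ∘ₗ (parityOperators C.P i).subtype)
  d_mem {i j} h f hf := by
    replace hf : f.1 C.one = 0 := hf
    change (C.Q * f.1 - i.negOnePow • (f.1 * C.Q)) C.one = 0
    rcases Int.units_eq_one_or i.negOnePow with h | h <;> simp [h, hf, C.Q_one]
  br_mem {i j k} h f g hf hg := by
    replace hf : f.1 C.one = 0 := hf
    replace hg : g.1 C.one = 0 := hg
    change (f.1 * g.1 - (i * j).negOnePow • (g.1 * f.1)) C.one = 0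
    rcases Int.units_eq_one_or (i * j).negOnePow with h | h <;> simp [h, hf, hg]

end CartanModule

/-! ### The model given by a Cartan module -/

namespace CartanModule

variable {L : DGLA.{u, w} K} {W : Type w'} [AddCommGroup W] [Module K W] (C : CartanModule L W)

/-- The homotopy fibre product of the cone of `L` and of the annihilator of the cyclic vector over
all operators; since the cone is acyclic, it is a model of the homotopy fibre of the inclusion of
the annihilator. -/
noncomputable abbrev fibre : DGLA.{u, max u w w'} K :=
  homotopyPullback C.action C.annihilator.incl

/-- The action of `L` by Lie derivatives, with values in the annihilator of the cyclic vector. -/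
def lieDerivative : Hom L C.annihilator.toDGLA where
  app i := (C.action.app i ∘ₗ L.toCone.app i).codRestrict (C.annihilator.carrier i) (fun a => by
    change (C.ρ i a + C.ι (i + 1) 0) C.one = 0
    rw [map_zero, add_zero, C.ρ_one])
  app_d h a := Subtype.ext (by
    change C.action.app _ (L.toCone.app _ _) =
      C.ops.d h (C.action.app _ (L.toCone.app _ a))
    rw [Hom.app_d, Hom.app_d])
  app_br h a b := Subtype.ext (by
    change C.action.app _ (L.toCone.app _ _) =
      C.ops.br h (C.action.app _ (L.toCone.app _ a)) (C.action.app _ (L.toCone.app _ b))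
    rw [Hom.app_br, Hom.app_br])

/-- The morphism from `L` to the fibre. -/
noncomputable def toFibre : Hom L C.fibre :=
  homotopyPullback.lift C.action C.annihilator.incl L.toCone C.lieDerivative (fun _ _ => rfl)

/-- The shifted complex underlying a Cartan module. -/
abbrev shift : DGLA.{u, w'} K := shiftedComplex C.P C.Q C.P_mul_Q C.Q_mul_Q

theorem smulRight_mem {i j : ℤ} (h : i + 1 = j) {s : W} (hs : C.P s = (j + 1).negOnePow • s) :
    C.aug.smulRight s ∈ parityOperators C.P i := by
  subst h
  rw [mem_parityOperators]
  ext x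
  rw [Int.negOnePow_succ, Int.negOnePow_succ, neg_neg] at hs
  change C.P (C.aug x • s) = i.negOnePow • (C.aug (C.P x) • s)
  rw [map_smul, hs, C.aug_P, smul_comm]

/-- The operator `x ↦ aug x • s` attached to an element `s`. -/
def rankOne {i j : ℤ} (h : i + 1 = j) : C.shift j →ₗ[K] C.ops i where
  toFun s := ⟨C.aug.smulRight s.1, C.smulRight_mem h (sub_eq_zero.1 s.2)⟩
  map_add' s s' := Subtype.ext (by
    change C.aug.smulRight (s.1 + s'.1) = C.aug.smulRight s.1 + C.aug.smulRight s'.1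
    ext x
    simp)
  map_smul' c s := Subtype.ext (by
    change C.aug.smulRight (c • s.1) = c • C.aug.smulRight s.1
    ext x
    simp [smul_comm c])

theorem d_rankOne {i j k : ℤ} (h : i + 1 = j) (h' : j + 1 = k) (s : C.shift j) :
    C.ops.d h (C.rankOne h s) = -C.rankOne h' (C.shift.d h' s) := Subtype.ext (by
  change C.Q * C.aug.smulRight s.1 - i.negOnePow • (C.aug.smulRight s.1 * C.Q) =
    -C.aug.smulRight (-C.Q s.1)
  have : C.aug.smulRight s.1 * C.Q = 0 := by
    ext x
    change C.aug (C.Q x) • s.1 = 0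
    rw [C.aug_Q, zero_smul]
  rw [this]
  ext x
  simp)

theorem rankOne_one {i j : ℤ} (h : i + 1 = j) (s : C.shift j) :
    (C.rankOne h s).1 C.one = s.1 := by
  change C.aug C.one • s.1 = s.1
  rw [C.aug_one, one_smul]

theorem d_apply_one {i j : ℤ} (h : i + 1 = j) (f : C.ops i) :
    (C.ops.d h f).1 C.one = C.Q (f.1 C.one) := by
  change (C.Q * f.1 - i.negOnePow • (f.1 * C.Q)) C.one = _
  rcases Int.units_eq_one_or i.negOnePow with h | h <;> simp [h, C.Q_one]

/-- The value at the cyclic vector. -/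
def evalOne {i j : ℤ} (h : i + 1 = j) (f : C.ops i) : C.shift j :=
  ⟨f.1 C.one, by
    subst h
    have hf : C.P (f.1 C.one) = i.negOnePow • f.1 (C.P C.one) := LinearMap.congr_fun f.2 C.one
    rw [C.P_one] at hf
    rw [LinearMap.mem_ker, Int.negOnePow_succ, Int.negOnePow_succ, neg_neg]
    exact sub_eq_zero.2 hf⟩

/-- The morphism `s ↦ dt ⊗ (x ↦ aug x • s)` from the shifted complex to the fibre. It preserves
the zero bracket because `dt² = 0`. -/
noncomputable def shiftToFibre : Hom C.shift C.fibre where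
  app j := (LinearMap.inr K (L.cone j × C.annihilator.toDGLA j) (C.ops.polyForms j) ∘ₗ
      C.ops.dtForm (sub_add_cancel j 1) ∘ₗ C.rankOne (sub_add_cancel j 1)).codRestrict _
    (fun s =>
    ⟨(C.ops.evalHom_dtForm 0 (sub_add_cancel j 1) (C.rankOne (sub_add_cancel j 1) s)).trans
        (map_zero (C.action.app j)).symm,
      (C.ops.evalHom_dtForm 1 (sub_add_cancel j 1) (C.rankOne (sub_add_cancel j 1) s)).trans
        (map_zero (C.annihilator.incl.app j)).symm⟩)
  app_d {i j} h s := by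
    refine homotopyPullback.ext ?_ ?_ ?_
    · exact (map_zero (L.cone.d h)).symm
    · exact (map_zero (C.annihilator.toDGLA.d h)).symm
    · change C.ops.dtForm (sub_add_cancel j 1) (C.rankOne (sub_add_cancel j 1) (C.shift.d h s)) =
        C.ops.polyForms.d h
          (C.ops.dtForm (sub_add_cancel i 1) (C.rankOne (sub_add_cancel i 1) s))
      subst h
      rw [d_dtForm (h' := rfl), C.d_rankOne (sub_add_cancel i 1) rfl, map_neg, neg_neg]
      have key : ∀ {m n : ℤ} (h₁ h₂ : m + 1 = i + 1) (h₃ : n + 1 = i + 1) (t : C.shift (i + 1)),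
          C.ops.dtForm h₃ (C.rankOne h₃ t) = C.ops.dtForm h₂ (C.rankOne h₁ t) := by
        intro m n h₁ h₂ h₃ t
        obtain rfl : m = n := by omega
        rfl
      exact key _ _ _ _
  app_br {i j k} h s s' := by
    refine homotopyPullback.ext ?_ ?_ ?_
    · exact (map_zero (L.cone.br h 0)).symm
    · exact (map_zero (C.annihilator.toDGLA.br h 0)).symm
    · change C.ops.dtForm (sub_add_cancel k 1) (C.rankOne (sub_add_cancel k 1) 0) =
        C.ops.polyForms.br h
          (C.ops.dtForm (sub_add_cancel i 1) (C.rankOne (sub_add_cancel i 1) s))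
          (C.ops.dtForm (sub_add_cancel j 1) (C.rankOne (sub_add_cancel j 1) s'))
      rw [br_dtForm, map_zero, map_zero]

/-- The complex of a Cartan module is a model of the fibre: up to the acyclic cone, a cocycle of the
fibre is a path of operators from `0` to an operator killing the cyclic vector, and it is determined
in cohomology by the value at the cyclic vector of an integral of the path. -/
theorem isQuasiIso_shiftToFibre [CharZero K] : C.shiftToFibre.IsQuasiIso := by
  intro n
  constructor
  · rw [Hom.injective_cohomologyMap_iff]
    rintro s hs ⟨p, hp⟩
    have hc : L.cone.d (sub_add_cancel n 1) p.1.1.1 = 0 :=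
      (congrArg (fun q => q.1.1.1) hp).trans (by rfl)
    have he : C.ops.polyForms.d (sub_add_cancel n 1) p.1.2 =
      C.ops.dtForm (sub_add_cancel n 1) (C.rankOne (sub_add_cancel n 1) s) :=
      congrArg (fun q => q.1.2) hp
    obtain ⟨c', hc'⟩ := L.exists_cone_d_eq (sub_add_cancel (n - 1) 1) (sub_add_cancel n 1) _ hc
    have hs' : C.ops.d (sub_add_cancel n 1) (C.rankOne (sub_add_cancel n 1) s) = 0 := by
      rw [C.d_rankOne _ rfl, hs, map_zero, neg_zero]
    obtain ⟨v, hv⟩ := C.ops.exists_d_eq_sub (sub_add_cancel (n - 1) 1) (sub_add_cancel n 1)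
      (C.ops.linearPath (C.rankOne (sub_add_cancel n 1) s) - p.1.2)
      (by rw [map_sub, d_linearPath _ _ hs', he, sub_self])
    rw [map_sub, map_sub, evalHom_one_linearPath, evalHom_zero_linearPath,
      homotopyPullback.eval_zero, homotopyPullback.eval_one, ← hc', Hom.app_d] at hv
    -- evaluate at the cyclic vector
    have hv' : C.Q ((v - C.action.app _ c').1 C.one) = s.1 := by
      rw [← C.d_apply_one (sub_add_cancel (n - 1) 1), map_sub, hv]
      have h₀ : (C.annihilator.incl.app (n - 1) p.1.1.2).1 C.one = 0 := p.1.1.2.2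
      rw [← C.rankOne_one (sub_add_cancel n 1) s, zero_sub, sub_neg_eq_add, add_sub_cancel_right]
      change ((C.rankOne _ s).1 - (C.annihilator.incl.app (n - 1) p.1.1.2).1) C.one = _
      rw [LinearMap.sub_apply, h₀, sub_zero]
    refine ⟨-C.evalOne (sub_add_cancel (n - 1) 1) (v - C.action.app _ c'), Subtype.ext ?_⟩
    change -C.Q (-(v - C.action.app _ c').1 C.one) = s.1
    rw [map_neg, neg_neg, hv']
  · rw [Hom.surjective_cohomologyMap_iff]
    intro p hp
    have hc : L.cone.d rfl p.1.1.1 = 0 := congrArg (fun q => q.1.1.1) hp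
    have he : C.ops.polyForms.d rfl p.1.2 = 0 := congrArg (fun q => q.1.2) hp
    obtain ⟨c', hc'⟩ := L.exists_cone_d_eq (sub_add_cancel n 1) rfl _ hc
    obtain ⟨e₁, he₁, he₁'⟩ := C.ops.exists_path (C.action.app _ c') 0
    obtain ⟨z, hz, hz₀⟩ := C.ops.exists_primitive (sub_add_cancel n 1) rfl
      (p.1.2 - C.ops.polyForms.d (sub_add_cancel n 1) e₁)
      (by rw [map_sub, he, d_d, sub_zero])
      (by rw [map_sub, homotopyPullback.eval_zero, Hom.app_d, he₁, ← Hom.app_d, hc', sub_self])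
    have hz₁ : C.ops.d (sub_add_cancel n 1) ((C.ops.evalHom 1).app _ z) =
        C.annihilator.incl.app n p.1.1.2 := by
      rw [← Hom.app_d, hz, map_sub, homotopyPullback.eval_one, Hom.app_d, he₁', map_zero, sub_zero]
    let f := (C.ops.evalHom 1).app _ z
    let s := C.evalOne (sub_add_cancel n 1) f
    have hs : C.shift.d rfl s = 0 := Subtype.ext (by
      change -C.Q (f.1 C.one) = 0
      rw [← C.d_apply_one (sub_add_cancel n 1), hz₁]
      exact neg_eq_zero.2 p.1.1.2.2)
    have hs' : C.ops.d (sub_add_cancel n 1) (C.rankOne (sub_add_cancel n 1) s) = 0 := by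
      rw [C.d_rankOne _ rfl, hs, map_zero, neg_zero]
    -- the rank one operator of `s` corrects `f` to an operator annihilating the cyclic vector
    let b' : C.annihilator.toDGLA (n - 1) := ⟨f - C.rankOne (sub_add_cancel n 1) s, by
      change f.1 C.one - (C.rankOne (sub_add_cancel n 1) s).1 C.one = 0
      rw [C.rankOne_one]
      exact sub_self _⟩
    refine ⟨s, hs, -homotopyPullback.mk C.action C.annihilator.incl c' b'
      (e₁ + z - C.ops.linearPath (C.rankOne (sub_add_cancel n 1) s)) ?_ ?_, ?_⟩
    · rw [map_sub, map_add, he₁, hz₀, evalHom_zero_linearPath, add_zero, sub_zero]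
    · rw [map_sub, map_add, he₁', evalHom_one_linearPath, zero_add]
      rfl
    · rw [map_neg, neg_eq_iff_eq_neg, neg_sub]
      refine homotopyPullback.ext ?_ ?_ ?_
      · exact hc'.trans (sub_zero _).symm
      · refine Subtype.ext ?_
        refine Eq.trans ?_ (sub_zero _).symm
        change C.ops.d (sub_add_cancel n 1) (f - C.rankOne (sub_add_cancel n 1) s) =
          C.annihilator.incl.app n p.1.1.2
        rw [map_sub, hz₁, hs', sub_zero]
      · change C.ops.polyForms.d (sub_add_cancel n 1) (e₁ + z - C.ops.linearPath _) =
          p.1.2 - C.ops.dtForm (sub_add_cancel n 1) (C.rankOne (sub_add_cancel n 1) s)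
        rw [map_sub, map_add, hz, d_linearPath _ _ hs', add_sub_cancel]

/-- A relation in the fibre for the image of `a` yields an element `b` cohomologous to `a` whose
contraction of the cyclic vector is exact. -/
theorem injective_toFibre [CharZero K]
    (hC : ∀ {i j : ℤ} (h : i + 1 = j) (a : L j), (∀ {k : ℤ} (h' : j + 1 = k), L.d h' a = 0) →
      (∃ s, C.Q s = C.ι j a C.one) → ∃ b, L.d h b = a) (n : ℤ) :
    Function.Injective (C.toFibre.cohomologyMap n) := by
  rw [Hom.injective_cohomologyMap_iff]
  rintro a ha ⟨p, hp⟩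
  obtain ⟨⟨⟨c, b⟩, e⟩, hp₀, hp₁⟩ := p
  replace hp₀ : (C.ops.evalHom 0).app _ e = C.action.app _ c := hp₀
  replace hp₁ : (C.ops.evalHom 1).app _ e = C.annihilator.incl.app _ b := hp₁
  have hc : L.cone.d (sub_add_cancel n 1) c = L.toCone.app n a :=
    congrArg (fun q => q.1.1.1) hp
  have he : C.ops.polyForms.d (sub_add_cancel n 1) e =
      C.ops.constHom.app n (C.action.app n (L.toCone.app n a)) := congrArg (fun q => q.1.2) hp
  have hc₀ : L.d (sub_add_cancel n 1) c.1 + L.castDeg (sub_add_cancel n 1) c.2 = a :=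
    congrArg Prod.fst hc
  have hc₁ : L.d (by omega) c.2 = (0 : L (n + 1)) := neg_eq_zero.1 (congrArg Prod.snd hc)
  obtain ⟨v, hv⟩ := C.ops.exists_d_eq_sub (sub_add_cancel (n - 1) 1) (sub_add_cancel n 1)
    (e - C.ops.constHom.app _ (C.action.app _ c))
    (by rw [map_sub, he, ← hc, Hom.app_d, Hom.app_d, sub_self])
  rw [map_sub, map_sub, evalHom_constHom, evalHom_constHom, hp₀, hp₁, sub_self, sub_zero] at hv
  obtain ⟨x, hx⟩ := hC rfl c.2 (L.d_eq_zero_of_eq · hc₁) ⟨-v.1 C.one, by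
    have hb : (C.annihilator.incl.app _ b).1 C.one = 0 := b.2
    rw [map_neg, ← C.d_apply_one (sub_add_cancel (n - 1) 1), hv]
    change -((C.annihilator.incl.app _ b).1 C.one - (C.ρ _ c.1 + C.ι _ c.2) C.one) = _
    rw [hb, LinearMap.add_apply, C.ρ_one]
    simp⟩
  refine ⟨c.1 + x, ?_⟩
  rw [map_add, ← hc₀, ← hx, L.castDeg_d']

end CartanModule

/-- A DGLA `L` with a Cartan module in which the contractions of the cyclic vector detect the
cohomology of `L` is homotopy abelian. -/
theorem CartanModule.isHomotopyAbelian [CharZero K] {L : DGLA.{u, w} K} {W : Type (max u w)}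
    [AddCommGroup W] [Module K W] (C : CartanModule L W)
    (hC : ∀ {i j : ℤ} (h : i + 1 = j) (a : L j), (∀ {k : ℤ} (h' : j + 1 = k), L.d h' a = 0) →
      (∃ s, C.Q s = C.ι j a C.one) → ∃ b, L.d h b = a) : L.IsHomotopyAbelian := by
  have hq := homotopyPullback.isQuasiIso_fst C.toFibre C.shiftToFibre C.isQuasiIso_shiftToFibre
  refine IsHomotopyAbelian.of_injective (homotopyPullback.fst C.toFibre C.shiftToFibre) hq
    (homotopyPullback.snd C.toFibre C.shiftToFibre) (fun n => ?_) (fun _ _ _ => rfl)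
  rw [Hom.injective_cohomologyMap_iff]
  rintro p hp ⟨s, hs⟩
  refine (Hom.injective_cohomologyMap_iff _ n).1 (hq n).1 p hp ?_
  change C.shift.d _ s = p.1.1.2 at hs
  have ha : L.d rfl p.1.1.1 = 0 :=
      (congrArg (fun q => q.1.1.1) hp).trans (by rfl)
  have he : C.fibre.polyForms.d rfl p.1.2 = 0 := congrArg (fun q => q.1.2) hp
  obtain ⟨v, hv⟩ := C.fibre.exists_d_eq_sub (sub_add_cancel n 1) rfl p.1.2 he
  rw [homotopyPullback.eval_zero, homotopyPullback.eval_one, ← hs, Hom.app_d] at hv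
  refine (Hom.injective_cohomologyMap_iff _ n).1 (C.injective_toFibre hC n) _ ha
    ⟨C.shiftToFibre.app _ s - v, ?_⟩
  rw [map_sub, hv]
  abel

/-! ### The supersymmetric algebra of the shift -/

/-- The relations of the supersymmetric algebra: linearity of the generators in each degree and
supercommutativity, where the generator of `a` has the parity of `|a| + 1`. -/
inductive SuperSymRel (L : DGLA.{u, w} K) :
    FreeAlgebra K (Σ i, L i) → FreeAlgebra K (Σ i, L i) → Prop
  | add {i : ℤ} (a b : L i) : SuperSymRel L (FreeAlgebra.ι K ⟨i, a + b⟩)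
      (FreeAlgebra.ι K ⟨i, a⟩ + FreeAlgebra.ι K ⟨i, b⟩)
  | smul {i : ℤ} (c : K) (a : L i) : SuperSymRel L (FreeAlgebra.ι K ⟨i, c • a⟩)
      (c • FreeAlgebra.ι K ⟨i, a⟩)
  | comm {i j : ℤ} (a : L i) (b : L j) : SuperSymRel L
      (FreeAlgebra.ι K ⟨i, a⟩ * FreeAlgebra.ι K ⟨j, b⟩)
      (((i + 1) * (j + 1)).negOnePow • (FreeAlgebra.ι K ⟨j, b⟩ * FreeAlgebra.ι K ⟨i, a⟩))

/-- The supersymmetric algebra on the shift `L[1]`, as a quotient of the free algebra on the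
disjoint union of the components. It carries no grading; the parity is recorded by an
automorphism. -/
def SuperSym (L : DGLA.{u, w} K) : Type (max u w) := RingQuot (SuperSymRel L)

namespace SuperSym

variable (L : DGLA.{u, w} K)

noncomputable instance : Ring (SuperSym L) := inferInstanceAs (Ring (RingQuot (SuperSymRel L)))

noncomputable instance : Algebra K (SuperSym L) :=
  inferInstanceAs (Algebra K (RingQuot (SuperSymRel L)))

-- a shortcut, needed for the ring lemmas on operators to find the instance
noncomputable instance : Ring (Module.End K (SuperSym L)) := Module.End.instRing

/-- The quotient map from the free algebra. -/
noncomputable def mkHom : FreeAlgebra K (Σ i, L i) →ₐ[K] SuperSym L :=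
  RingQuot.mkAlgHom K (SuperSymRel L)

variable {L}

theorem mkHom_rel {x y : FreeAlgebra K (Σ i, L i)} (h : SuperSymRel L x y) :
    mkHom L x = mkHom L y := RingQuot.mkAlgHom_rel K h

theorem map_units_smul' {V V' : Type*} [AddCommGroup V] [AddCommGroup V'] {F : Type*}
    [FunLike F V V'] [AddMonoidHomClass F V V'] (f : F) (ε : ℤˣ) (x : V) : f (ε • x) = ε • f x := by
  rcases Int.units_eq_one_or ε with rfl | rfl <;> simp

/-- The generator given by `a`, of the parity of `|a| + 1`. -/
noncomputable def gen (i : ℤ) : L i →ₗ[K] SuperSym L where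
  toFun a := mkHom L (FreeAlgebra.ι K ⟨i, a⟩)
  map_add' a b := (mkHom_rel (SuperSymRel.add a b)).trans (map_add _ _ _)
  map_smul' c a := (mkHom_rel (SuperSymRel.smul c a)).trans (map_smul _ _ _)

theorem gen_mul_gen {i j : ℤ} (a : L i) (b : L j) :
    gen i a * gen j b = ((i + 1) * (j + 1)).negOnePow • (gen j b * gen i a) := by
  have := mkHom_rel (SuperSymRel.comm a b)
  rwa [map_units_smul', map_mul, map_mul] at this

/-- The universal property of the supersymmetric algebra. -/
noncomputable def lift {R : Type*} [Ring R] [Algebra K R] (f : ∀ i, L i →ₗ[K] R)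
    (hf : ∀ {i j : ℤ} (a : L i) (b : L j),
      f i a * f j b = ((i + 1) * (j + 1)).negOnePow • (f j b * f i a)) : SuperSym L →ₐ[K] R :=
  RingQuot.liftAlgHom K ⟨FreeAlgebra.lift K (fun a => f a.1 a.2), by
    intro x y h
    induction h with
    | add a b => simp
    | smul c a => simp
    | comm a b => simpa [map_units_smul'] using hf a b⟩

theorem lift_gen {R : Type*} [Ring R] [Algebra K R] (f : ∀ i, L i →ₗ[K] R)
    (hf : ∀ {i j : ℤ} (a : L i) (b : L j),
      f i a * f j b = ((i + 1) * (j + 1)).negOnePow • (f j b * f i a)) {i : ℤ} (a : L i) :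
    lift f hf (gen i a) = f i a := by
  refine (RingQuot.liftAlgHom_mkAlgHom_apply K _ _ _).trans ?_
  simp

/-- An induction principle: the elements are sums of multiples of products of generators. -/
theorem induction {p : SuperSym L → Prop} (one : p 1)
    (gen_mul : ∀ (i : ℤ) (a : L i) (s : SuperSym L), p s → p (gen i a * s))
    (add : ∀ s t, p s → p t → p (s + t)) (smul : ∀ (c : K) s, p s → p (c • s))
    (s : SuperSym L) : p s := by
  obtain ⟨x, rfl⟩ := RingQuot.mkAlgHom_surjective K (SuperSymRel L) s
  change p (mkHom L x)
  suffices ∀ s, p s → p (mkHom L x * s) by simpa using this 1 one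
  induction x using FreeAlgebra.induction with
  | grade0 c =>
    intro s hs
    rw [AlgHom.commutes, ← Algebra.smul_def]
    exact smul c s hs
  | grade1 a => exact gen_mul a.1 a.2
  | mul x y hx hy =>
    intro s hs
    rw [map_mul, mul_assoc]
    exact hx _ (hy _ hs)
  | add x y hx hy =>
    intro s hs
    rw [map_add, add_mul]
    exact add _ _ (hx _ hs) (hy _ hs)

/-! ### Operators determined by their supercommutators with multiplications -/

/-- Multiplication by a generator. -/
noncomputable def mulGen (i : ℤ) : L i →ₗ[K] Module.End K (SuperSym L) :=
  LinearMap.mul K (SuperSym L) ∘ₗ gen i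

theorem mulGen_mul_mulGen {i j : ℤ} (a : L i) (b : L j) :
    mulGen i a * mulGen j b = ((i + 1) * (j + 1)).negOnePow • (mulGen j b * mulGen i a) := by
  ext s
  change gen i a * (gen j b * s) = ((i + 1) * (j + 1)).negOnePow • (gen j b * (gen i a * s))
  rw [← mul_assoc, gen_mul_gen, smul_mul_assoc, mul_assoc]

/-- The operator `X` of parity `p` kills `1` and its supercommutator with multiplication by the
generator of `a` is `x a`. -/
structure HasCommutator (p : ℤ) (x : ∀ i, L i →ₗ[K] Module.End K (SuperSym L))
    (X : Module.End K (SuperSym L)) : Prop where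
  apply_one : X 1 = 0
  mul_mulGen : ∀ {i : ℤ} (a : L i),
    X * mulGen i a = x i a + (p * (i + 1)).negOnePow • (mulGen i a * X)

/-- An operator that kills `1` and supercommutes with the generators is zero. -/
theorem eq_zero_of_mul_mulGen {X : Module.End K (SuperSym L)} (h₁ : X 1 = 0)
    (h : ∀ {i : ℤ} (a : L i), ∃ ε : ℤˣ, X * mulGen i a = ε • (mulGen i a * X)) : X = 0 := by
  ext s
  induction s using SuperSym.induction with
  | one => exact h₁
  | gen_mul i a s hs =>
    obtain ⟨ε, hε⟩ := h a
    refine (LinearMap.congr_fun hε s).trans ?_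
    change ε • (gen i a * X s) = 0
    rw [hs]
    simp
  | add s t hs ht => rw [map_add, hs, ht, map_add]
  | smul c s hs => rw [map_smul, hs, map_smul]

theorem HasCommutator.unique {p : ℤ} {x : ∀ i, L i →ₗ[K] Module.End K (SuperSym L)}
    {X Y : Module.End K (SuperSym L)} (hX : HasCommutator p x X) (hY : HasCommutator p x Y) :
    X = Y := by
  rw [← sub_eq_zero]
  refine eq_zero_of_mul_mulGen (by simp [hX.apply_one, hY.apply_one])
    (fun {i} a => ⟨(p * (i + 1)).negOnePow, ?_⟩)
  rw [sub_mul, mul_sub, smul_sub, hX.mul_mulGen, hY.mul_mulGen]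
  abel

/-- Operators with prescribed supercommutators exist under the evident compatibility condition:
they are read off from an action of the supersymmetric algebra on two copies of itself. -/
theorem exists_hasCommutator (p : ℤ) (x : ∀ i, L i →ₗ[K] Module.End K (SuperSym L))
    (hx : ∀ {i j : ℤ} (a : L i) (b : L j),
      x i a * mulGen j b + (p * (i + 1)).negOnePow • (mulGen i a * x j b) =
        ((i + 1) * (j + 1)).negOnePow •
          (x j b * mulGen i a + (p * (j + 1)).negOnePow • (mulGen j b * x i a))) :
    ∃ X, HasCommutator p x X := by
  -- the generator of `a` acts by a triangular matrix with diagonal `(a, ± a)` and corner `x a`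
  let T (i : ℤ) : L i →ₗ[K] Module.End K (SuperSym L × SuperSym L) :=
    { toFun := fun a => LinearMap.prod (mulGen i a ∘ₗ LinearMap.fst K _ _)
        (x i a ∘ₗ LinearMap.fst K _ _ +
          (p * (i + 1)).negOnePow • (mulGen i a ∘ₗ LinearMap.snd K _ _))
      map_add' := fun a b => by
        refine LinearMap.ext fun s => Prod.ext ?_ ?_
        · simp
        · simp [smul_add]
          abel
      map_smul' := fun c a => by
        refine LinearMap.ext fun s => Prod.ext ?_ ?_
        · simp
        · simp [smul_comm c] }
  have hT {i : ℤ} (a : L i) (s : SuperSym L × SuperSym L) :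
      T i a s = (gen i a * s.1, x i a s.1 + (p * (i + 1)).negOnePow • (gen i a * s.2)) := rfl
  let F := lift T (fun {i j} a b => by
    refine LinearMap.ext fun s => Prod.ext ?_ ?_
    · exact LinearMap.congr_fun (mulGen_mul_mulGen a b) s.1
    · change x i a (gen j b * s.1) + (p * (i + 1)).negOnePow • (gen i a * (x j b s.1 +
          (p * (j + 1)).negOnePow • (gen j b * s.2))) =
        ((i + 1) * (j + 1)).negOnePow • (x j b (gen i a * s.1) +
          (p * (j + 1)).negOnePow • (gen j b * (x i a s.1 +
            (p * (i + 1)).negOnePow • (gen i a * s.2))))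
      have h₁ : x i a (gen j b * s.1) + (p * (i + 1)).negOnePow • (gen i a * x j b s.1) =
          ((i + 1) * (j + 1)).negOnePow •
            (x j b (gen i a * s.1) + (p * (j + 1)).negOnePow • (gen j b * x i a s.1)) :=
        LinearMap.congr_fun (hx a b) s.1
      have h₂ : gen i a * (gen j b * s.2) =
          ((i + 1) * (j + 1)).negOnePow • (gen j b * (gen i a * s.2)) :=
        LinearMap.congr_fun (mulGen_mul_mulGen a b) s.2
      rw [mul_add (gen i a), mul_add (gen j b), mul_smul_comm, mul_smul_comm, h₂, smul_add,
        ← add_assoc, h₁]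
      simp only [smul_add, smul_smul]
      rw [add_assoc]
      congr 3
      ac_rfl)
  have hF {i : ℤ} (a : L i) (s t : SuperSym L) :
      F (gen i a * s) (1, 0) = T i a (F s (1, 0)) := by
    rw [map_mul, lift_gen]
    rfl
  have hfst (s : SuperSym L) : (F s (1, 0)).1 = s := by
    induction s using SuperSym.induction with
    | one => rw [map_one]; rfl
    | gen_mul i a s hs => rw [hF a s 0, hT, hs]
    | add s t hs ht => rw [map_add, LinearMap.add_apply, Prod.fst_add, hs, ht]
    | smul c s hs => rw [map_smul, LinearMap.smul_apply, Prod.smul_fst, hs]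
  refine ⟨LinearMap.snd K _ _ ∘ₗ LinearMap.applyₗ (1, 0) ∘ₗ F.toLinearMap, ?_, fun {i} a => ?_⟩
  · change (F 1 (1, 0)).2 = 0
    rw [map_one]
    rfl
  · ext s
    change (F (gen i a * s) (1, 0)).2 = x i a s + (p * (i + 1)).negOnePow •
      (gen i a * (F s (1, 0)).2)
    rw [hF a s 0, hT, hfst]

theorem HasCommutator.add {p : ℤ} {x y : ∀ i, L i →ₗ[K] Module.End K (SuperSym L)}
    {X Y : Module.End K (SuperSym L)} (hX : HasCommutator p x X) (hY : HasCommutator p y Y) :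
    HasCommutator p (fun i => x i + y i) (X + Y) where
  apply_one := by simp [hX.apply_one, hY.apply_one]
  mul_mulGen {i} a := by
    rw [add_mul, mul_add (mulGen i a), smul_add, hX.mul_mulGen, hY.mul_mulGen, LinearMap.add_apply]
    abel

theorem HasCommutator.smul {p : ℤ} {x : ∀ i, L i →ₗ[K] Module.End K (SuperSym L)}
    {X : Module.End K (SuperSym L)} (hX : HasCommutator p x X) (c : K) :
    HasCommutator p (fun i => c • x i) (c • X) where
  apply_one := by simp [hX.apply_one]
  mul_mulGen {i} a := by
    rw [smul_mul_assoc, mul_smul_comm, hX.mul_mulGen, smul_add, LinearMap.smul_apply, smul_comm c]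

/-- Linear maps of degree `p` modulo two extend to derivations of parity `p`. -/
theorem exists_derivation (p : ℤ) {t : ℤ → ℤ} (ht : ∀ i, ∃ m, t i = i + p + 2 * m)
    (φ : ∀ i, L i →ₗ[K] L (t i)) : ∃ X, HasCommutator p (fun i => mulGen (t i) ∘ₗ φ i) X := by
  refine exists_hasCommutator p _ (fun {i j} a b => ?_)
  obtain ⟨m, hm⟩ := ht i
  obtain ⟨n, hn⟩ := ht j
  simp only [LinearMap.comp_apply]
  have h₁ : ((t i + 1) * (j + 1)).negOnePow = ((i + 1) * (j + 1) + p * (j + 1)).negOnePow :=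
    (Int.negOnePow_eq_iff _ _).2 ⟨(j + 1) * m, by rw [hm]; ring⟩
  have h₂ : (p * (i + 1) + (i + 1) * (t j + 1)).negOnePow = ((i + 1) * (j + 1)).negOnePow :=
    (Int.negOnePow_eq_iff _ _).2 ⟨p * (i + 1) + (i + 1) * n, by rw [hn]; ring⟩
  rw [mulGen_mul_mulGen (φ i a) b, mulGen_mul_mulGen a (φ j b), smul_add, smul_smul, smul_smul,
    add_comm, ← Int.negOnePow_add, ← Int.negOnePow_add, h₁, h₂]

end SuperSym

/-! ### Homotopies of the bracket -/

/-- A graded antisymmetric bilinear map `h` of degree `-1` that is a null homotopy of the bracket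
and satisfies the cyclic identity `∮ [h(a, b), c] + ∮ h([a, b], c) = 0`. All degrees are independent
indices, so that the structure can be transferred without transports. -/
structure BracketHomotopy (L : DGLA.{u, w} K) where
  /-- The bilinear map. -/
  h : ∀ {i j k : ℤ}, i + j - 1 = k → (L i →ₗ[K] L j →ₗ[K] L k)
  antisymm : ∀ {i j k : ℤ} (hij : i + j - 1 = k) (hji : j + i - 1 = k) (a : L i) (b : L j),
    h hij a b = -((i * j).negOnePow • h hji b a)
  homotopy : ∀ {i j k n i' j' : ℤ} (hij : i + j = k) (hn : i + j - 1 = n) (hk : n + 1 = k)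
    (hi : i + 1 = i') (hj : j + 1 = j') (h₁ : i' + j - 1 = k) (h₂ : i + j' - 1 = k)
    (a : L i) (b : L j), L.br hij a b =
      L.d hk (h hn a b) + h h₁ (L.d hi a) b + i.negOnePow • h h₂ a (L.d hj b)
  cyclic : ∀ {i j k n ij jk ki ij' jk' ki' : ℤ} (hij : i + j - 1 = ij) (hjk : j + k - 1 = jk)
    (hki : k + i - 1 = ki) (h₁ : ij + k = n) (h₂ : jk + i = n) (h₃ : ki + j = n)
    (hij' : i + j = ij') (hjk' : j + k = jk') (hki' : k + i = ki') (h₁' : ij' + k - 1 = n)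
    (h₂' : jk' + i - 1 = n) (h₃' : ki' + j - 1 = n) (a : L i) (b : L j) (c : L k),
    (L.br h₁ (h hij a b) c + (i * (j + k)).negOnePow • L.br h₂ (h hjk b c) a +
        (k * (i + j)).negOnePow • L.br h₃ (h hki c a) b) +
      (h h₁' (L.br hij' a b) c + (i * (j + k)).negOnePow • h h₂' (L.br hjk' b c) a +
        (k * (i + j)).negOnePow • h h₃' (L.br hki' c a) b) = 0

open SuperSym

/-! ### The operators of the supersymmetric algebra -/

section
variable (L : DGLA.{u, w} K)

theorem exists_lieDer {i : ℤ} (a : L i) : ∃ X, HasCommutator i (fun j =>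
    mulGen (i + j) ∘ₗ (i.negOnePow • L.br (rfl : i + j = i + j) a)) X :=
  exists_derivation i (fun j => ⟨0, by ring⟩) _

/-- The derivation of the supersymmetric algebra induced by `[a, -]`. -/
noncomputable def lieDer (i : ℤ) : L i →ₗ[K] Module.End K (SuperSym L) where
  toFun a := (L.exists_lieDer a).choose
  map_add' a b := by
    refine (L.exists_lieDer (a + b)).choose_spec.unique ?_
    convert (L.exists_lieDer a).choose_spec.add (L.exists_lieDer b).choose_spec using 1
    ext
    simp [smul_add]
  map_smul' c a := by
    refine (L.exists_lieDer (c • a)).choose_spec.unique ?_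
    convert (L.exists_lieDer a).choose_spec.smul c using 1
    · ext
      simp [smul_comm c]
    · rfl

theorem lieDer_one {i : ℤ} (a : L i) : L.lieDer i a 1 = 0 :=
  (L.exists_lieDer a).choose_spec.apply_one

theorem lieDer_mul_mulGen {i j k : ℤ} (h : i + j = k) (a : L i) (b : L j) :
    L.lieDer i a * mulGen j b =
      i.negOnePow • mulGen k (L.br h a b) +
        (i * (j + 1)).negOnePow • (mulGen j b * L.lieDer i a) := by
  subst h
  refine ((L.exists_lieDer a).choose_spec.mul_mulGen b).trans ?_
  rw [LinearMap.comp_apply, LinearMap.smul_apply, map_units_smul']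
  rfl

theorem exists_diff : ∃ X, HasCommutator 1 (fun j => mulGen (j + 1) ∘ₗ
    (-L.d (rfl : j + 1 = j + 1))) X :=
  exists_derivation 1 (fun j => ⟨0, by ring⟩) _

/-- The derivation of the supersymmetric algebra induced by the differential. -/
noncomputable def diff : Module.End K (SuperSym L) := L.exists_diff.choose

theorem diff_one : L.diff 1 = 0 := L.exists_diff.choose_spec.apply_one

theorem diff_mul_mulGen {i j : ℤ} (h : i + 1 = j) (a : L i) :
    L.diff * mulGen i a = -mulGen j (L.d h a) + (i + 1).negOnePow • (mulGen i a * L.diff) := by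
  subst h
  refine (L.exists_diff.choose_spec.mul_mulGen a).trans ?_
  rw [one_mul, ← map_neg]
  rfl

theorem diff_mul_diff : L.diff * L.diff = 0 := by
  refine eq_zero_of_mul_mulGen (by simp [diff_one]) (fun {i} a => ⟨1, ?_⟩)
  rw [mul_assoc, L.diff_mul_mulGen rfl, mul_add, mul_neg, L.diff_mul_mulGen rfl, L.d_d,
    mul_smul_comm, ← mul_assoc, L.diff_mul_mulGen rfl]
  rcases Int.even_or_odd i with hi | hi <;>
    simp [Int.negOnePow_even, Int.negOnePow_odd, hi, add_mul, mul_assoc]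

theorem exists_brDiff : ∃ X, HasCommutator 1 (fun j => L.lieDer j) X := by
  refine exists_hasCommutator 1 _ (fun {i j} a b => ?_)
  rw [L.lieDer_mul_mulGen rfl, L.lieDer_mul_mulGen (add_comm j i) b a,
    L.br_antisymm rfl (add_comm j i) a b]
  rcases Int.even_or_odd i with hi | hi <;> rcases Int.even_or_odd j with hj | hj <;>
    simp [Int.negOnePow_add, Int.negOnePow_even, Int.negOnePow_odd, hi, hj, mul_add, add_mul]
      <;> abel

/-- The second order operator of the supersymmetric algebra given by the bracket: it kills `1`, and
its supercommutator with multiplication by the generator of `a` is the Lie derivative of `a`. -/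
noncomputable def brDiff : Module.End K (SuperSym L) := L.exists_brDiff.choose

theorem brDiff_one : L.brDiff 1 = 0 := L.exists_brDiff.choose_spec.apply_one

theorem brDiff_mul_mulGen {i : ℤ} (a : L i) :
    L.brDiff * mulGen i a = L.lieDer i a + (i + 1).negOnePow • (mulGen i a * L.brDiff) := by
  refine (L.exists_brDiff.choose_spec.mul_mulGen a).trans ?_
  rw [one_mul]
  rfl

end

namespace BracketHomotopy

variable {L : DGLA.{u, w} K} (H : BracketHomotopy L)

theorem exists_der {i : ℤ} (a : L i) : ∃ X, HasCommutator (i + 1) (fun j =>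
    mulGen (i + j - 1) ∘ₗ (i.negOnePow • H.h (rfl : i + j - 1 = i + j - 1) a)) X :=
  exists_derivation (i + 1) (fun j => ⟨-1, by ring⟩) _

/-- The derivation of the supersymmetric algebra induced by `h(a, -)`. -/
noncomputable def der (i : ℤ) : L i →ₗ[K] Module.End K (SuperSym L) where
  toFun a := (H.exists_der a).choose
  map_add' a b := by
    refine (H.exists_der (a + b)).choose_spec.unique ?_
    convert (H.exists_der a).choose_spec.add (H.exists_der b).choose_spec using 1
    ext
    simp [smul_add]
  map_smul' c a := by
    refine (H.exists_der (c • a)).choose_spec.unique ?_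
    convert (H.exists_der a).choose_spec.smul c using 1
    · ext
      simp [smul_comm c]
    · rfl

theorem der_one {i : ℤ} (a : L i) : H.der i a 1 = 0 :=
  (H.exists_der a).choose_spec.apply_one

theorem der_mul_mulGen {i j k : ℤ} (h : i + j - 1 = k) (a : L i) (b : L j) :
    H.der i a * mulGen j b = i.negOnePow • mulGen k (H.h h a b) +
      ((i + 1) * (j + 1)).negOnePow • (mulGen j b * H.der i a) := by
  subst h
  refine ((H.exists_der a).choose_spec.mul_mulGen b).trans ?_
  rw [LinearMap.comp_apply, LinearMap.smul_apply, map_units_smul']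
  rfl

theorem exists_op : ∃ X, HasCommutator 0 (fun j => H.der j) X := by
  refine exists_hasCommutator 0 _ (fun {i j} a b => ?_)
  rw [H.der_mul_mulGen rfl, H.der_mul_mulGen (k := i + j - 1) (by omega) b a,
    H.antisymm rfl (by omega) a b]
  rcases Int.even_or_odd i with hi | hi <;> rcases Int.even_or_odd j with hj | hj <;>
    simp [Int.negOnePow_add, Int.negOnePow_even, Int.negOnePow_odd, hi, hj, mul_add, add_mul]
      <;> abel

/-- The second order operator of the supersymmetric algebra given by `h`: it kills `1`, and its
commutator with multiplication by the generator of `a` is the derivation induced by `h(a, -)`. -/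
noncomputable def op : Module.End K (SuperSym L) := H.exists_op.choose

theorem op_one : H.op 1 = 0 := H.exists_op.choose_spec.apply_one

theorem op_mul_mulGen {i : ℤ} (a : L i) :
    H.op * mulGen i a = H.der i a + mulGen i a * H.op := by
  refine (H.exists_op.choose_spec.mul_mulGen a).trans ?_
  rw [zero_mul, Int.negOnePow_zero, one_smul]
  rfl

/-- The homotopy formula, as a relation between derivations of the supersymmetric algebra. -/
theorem diff_mul_der {i j : ℤ} (h : i + 1 = j) (a : L i) :
    L.diff * H.der i a = -L.lieDer i a - H.der j (L.d h a) +
      (i + 1).negOnePow • (H.der i a * L.diff) := by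
  rw [← sub_eq_zero]
  refine eq_zero_of_mul_mulGen ?_ (fun {m} b => ⟨(i * (m + 1)).negOnePow, ?_⟩)
  · rcases Int.units_eq_one_or (i + 1).negOnePow with h | h <;>
      simp [h, der_one, lieDer_one, diff_one]
  subst h
  have e₁ := H.homotopy (n := i + m - 1) (i' := i + 1) (j' := m + 1) rfl rfl (by omega) rfl rfl
    (by omega) (by omega) a b
  have e₂ := H.der_mul_mulGen (k := i + m) (by omega) a (L.d rfl b)
  have e₃ := H.der_mul_mulGen (k := i + m) (by omega) (L.d rfl a) b
  have e₄ := H.der_mul_mulGen rfl a b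
  have e₅ := L.diff_mul_mulGen rfl b
  have e₆ := L.lieDer_mul_mulGen rfl a b
  have e₇ := L.diff_mul_mulGen (j := i + m) (by omega) (H.h rfl a b)
  have f₁ : L.diff * (H.der i a * mulGen m b) = L.diff * _ := congrArg _ e₄
  have f₂ : ∀ x, L.diff * (mulGen m b * x) = _ := fun x => by rw [← mul_assoc, e₅]
  have f₃ : ∀ x, H.der i a * (mulGen m b * x) = _ := fun x => by rw [← mul_assoc, e₄]
  rw [sub_mul, add_mul, sub_mul, neg_mul, smul_mul_assoc, mul_assoc, mul_assoc, e₄, e₅, e₆, e₃,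
    mul_add, mul_add, e₁]
  rcases Int.even_or_odd i with hi | hi <;> rcases Int.even_or_odd m with hm | hm <;>
    simp [Int.negOnePow_add, Int.negOnePow_even, Int.negOnePow_odd, hi, hm, mul_add, add_mul,
      mul_sub, e₂, e₇, f₂, f₃, mul_assoc]
      <;> abel

/-- The homotopy formula says that the bracket operator is the commutator of `op` and `diff`. -/
theorem op_mul_diff : H.op * L.diff = L.diff * H.op + L.brDiff := by
  rw [← sub_eq_zero]
  refine eq_zero_of_mul_mulGen (by simp [op_one, diff_one, brDiff_one]) (fun {i} a =>
    ⟨(i + 1).negOnePow, ?_⟩)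
  have e₁ := H.diff_mul_der rfl a
  have e₂ := L.diff_mul_mulGen rfl a
  have e₃ := H.op_mul_mulGen a
  have f₂ : ∀ x, L.diff * (mulGen i a * x) = _ := fun x => by rw [← mul_assoc, e₂]
  have f₃ : ∀ x, H.op * (mulGen i a * x) = _ := fun x => by rw [← mul_assoc, e₃]
  rw [sub_mul, add_mul, mul_assoc, mul_assoc, e₂, e₃, mul_add, mul_add, e₁, f₂, mul_neg,
    H.op_mul_mulGen, L.brDiff_mul_mulGen, mul_smul_comm, f₃]
  rcases Int.even_or_odd i with hi | hi <;>
    simp [Int.negOnePow_even, Int.negOnePow_odd, hi, mul_add, add_mul, mul_sub, mul_assoc] <;> abel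

end BracketHomotopy

namespace BracketHomotopy

variable {L : DGLA.{u, w} K} (H : BracketHomotopy L)

/-! ### Commutation of the second order operators -/

set_option maxHeartbeats 2000000 in
/-- The cyclic identity, as a relation between derivations of the supersymmetric algebra. -/
theorem der_br {i j ij m : ℤ} (hij : i + j = ij) (hm : i + j - 1 = m) (a : L i) (b : L j) :
    i.negOnePow • H.der ij (L.br hij a b) - i.negOnePow • L.lieDer m (H.h hm a b) +
      (i * (j + 1)).negOnePow • (H.der j b * L.lieDer i a) - L.lieDer i a * H.der j b -
      ((i + 1) * (j + 1)).negOnePow • (L.lieDer j b * H.der i a) -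
      i.negOnePow • (H.der i a * L.lieDer j b) = 0 := by
  subst hij hm
  refine eq_zero_of_mul_mulGen ?_ (fun {k} c => ⟨((i + j + 1) * (k + 1)).negOnePow, ?_⟩)
  · rcases Int.even_or_odd i with hi | hi <;> rcases Int.even_or_odd j with hj | hj <;>
      simp [Int.negOnePow_add, Int.negOnePow_even, Int.negOnePow_odd, hi, hj, mul_add, add_mul,
        der_one, lieDer_one]
  obtain ⟨n, hn⟩ : ∃ n, n = i + j + k - 1 := ⟨_, rfl⟩
  have e := congrArg (fun x => j.negOnePow • mulGen n x) (H.cyclic rfl rfl rfl (n := n)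
    (by omega) (by omega) (by omega)
    rfl rfl rfl (by omega) (by omega) (by omega) a b c)
  have r₁ := H.der_mul_mulGen (k := n) (by omega) (L.br rfl a b) c
  have r₂ := L.lieDer_mul_mulGen (k := n) (by omega) (H.h rfl a b) c
  have ra := L.lieDer_mul_mulGen (add_comm i k) a c
  have rb := L.lieDer_mul_mulGen rfl b c
  have da := H.der_mul_mulGen (k := k + i - 1) (by omega) a c
  have db := H.der_mul_mulGen rfl b c
  have ra' : ∀ x, L.lieDer i a * (mulGen k c * x) = _ := fun x => by rw [← mul_assoc, ra]
  have rb' : ∀ x, L.lieDer j b * (mulGen k c * x) = _ := fun x => by rw [← mul_assoc, rb]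
  have da' : ∀ x, H.der i a * (mulGen k c * x) = _ := fun x => by rw [← mul_assoc, da]
  have db' : ∀ x, H.der j b * (mulGen k c * x) = _ := fun x => by rw [← mul_assoc, db]
  have g₁ := H.der_mul_mulGen (k := n) (by omega) b (L.br rfl c a)
  have g₂ := L.lieDer_mul_mulGen (k := n) (by omega) a (H.h rfl b c)
  have g₃ := L.lieDer_mul_mulGen (k := n) (by omega) b (H.h rfl c a)
  have g₄ := H.der_mul_mulGen (k := n) (by omega) a (L.br rfl b c)
  rw [H.antisymm _ (show k + i + j - 1 = n by omega)] at g₁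
  rw [L.br_antisymm _ (show j + k - 1 + i = n by omega)] at g₂
  rw [L.br_antisymm _ (show k + i - 1 + j = n by omega)] at g₃
  rw [H.antisymm _ (show j + k + i - 1 = n by omega)] at g₄
  rw [L.br_antisymm _ rfl a c] at ra ra'
  rw [H.antisymm _ rfl a c] at da da'
  rcases Int.even_or_odd i with hi | hi <;> rcases Int.even_or_odd j with hj | hj <;>
    rcases Int.even_or_odd k with hk | hk <;>
    (simp [Int.negOnePow_add, Int.negOnePow_sub, Int.negOnePow_even, Int.negOnePow_odd, hi, hj,
      hk, mul_add, add_mul, mul_sub, sub_mul, mul_assoc]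
      at e g₁ g₂ g₃ g₄ r₁ r₂ ra rb da db ra' rb' da' db' ⊢
     simp only [mul_neg, mul_add, g₁, g₂, g₃, g₄, r₁, r₂, ra, rb, da, db, ra', rb',
      da', db']
     linear_combination (norm := abel1) e)

theorem brDiff_mul_der {i : ℤ} (a : L i) :
    L.brDiff * H.der i a =
      H.op * L.lieDer i a - L.lieDer i a * H.op + (i + 1).negOnePow • (H.der i a * L.brDiff) := by
  rw [← sub_eq_zero]
  refine eq_zero_of_mul_mulGen ?_ (fun {j} b => ⟨(i * (j + 1)).negOnePow, ?_⟩)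
  · rcases Int.units_eq_one_or (i + 1).negOnePow with h | h <;>
      simp [h, der_one, lieDer_one, brDiff_one, op_one]
  have e := H.der_br rfl rfl a b
  have qb := L.brDiff_mul_mulGen b
  have ob := H.op_mul_mulGen b
  have rb := L.lieDer_mul_mulGen rfl a b
  have db := H.der_mul_mulGen rfl a b
  have qb' : ∀ x, L.brDiff * (mulGen j b * x) = _ := fun x => by rw [← mul_assoc, qb]
  have ob' : ∀ x, H.op * (mulGen j b * x) = _ := fun x => by rw [← mul_assoc, ob]
  have rb' : ∀ x, L.lieDer i a * (mulGen j b * x) = _ := fun x => by rw [← mul_assoc, rb]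
  have db' : ∀ x, H.der i a * (mulGen j b * x) = _ := fun x => by rw [← mul_assoc, db]
  have oc := H.op_mul_mulGen (L.br rfl a b)
  have qc := L.brDiff_mul_mulGen (H.h rfl a b)
  rcases Int.even_or_odd i with hi | hi <;> rcases Int.even_or_odd j with hj | hj <;>
    (simp [Int.negOnePow_add, Int.negOnePow_even, Int.negOnePow_odd, hi, hj, mul_add, add_mul,
      mul_sub, sub_mul, mul_assoc] at e qb rb db oc qc qb' rb' db' ob' ⊢
     simp only [mul_neg, mul_add, qb, ob, rb, db, oc, qc, qb', rb', db', ob']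
     linear_combination (norm := abel1) -e)

/-- The cyclic identity says that the two second order operators commute. -/
theorem op_mul_brDiff : H.op * L.brDiff = L.brDiff * H.op := by
  rw [← sub_eq_zero]
  refine eq_zero_of_mul_mulGen (by simp [op_one, brDiff_one]) (fun {i} a =>
    ⟨(i + 1).negOnePow, ?_⟩)
  have e := H.brDiff_mul_der a
  have qb := L.brDiff_mul_mulGen a
  have ob := H.op_mul_mulGen a
  have qb' : ∀ x, L.brDiff * (mulGen i a * x) = _ := fun x => by rw [← mul_assoc, qb]
  have ob' : ∀ x, H.op * (mulGen i a * x) = _ := fun x => by rw [← mul_assoc, ob]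
  rcases Int.even_or_odd i with hi | hi <;>
    (simp [Int.negOnePow_even, Int.negOnePow_odd, hi, add_mul, mul_sub, sub_mul, mul_assoc]
      at e qb qb' ob' ⊢
     simp only [mul_neg, mul_add, qb, ob, qb', ob', e]
     abel)

theorem diff_mul_brDiff (H : BracketHomotopy L) : L.diff * L.brDiff = -(L.brDiff * L.diff) := by
  have h : L.brDiff = H.op * L.diff - L.diff * H.op := by rw [H.op_mul_diff]; abel
  rw [h, mul_sub, sub_mul, mul_assoc, L.diff_mul_diff, ← mul_assoc L.diff L.diff, L.diff_mul_diff]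
  simp [mul_assoc]

/-- The bracket operator is the commutator of `op` and `diff`, it commutes with `op` and
anticommutes with `diff`; so its square is equal to its opposite. -/
theorem brDiff_mul_brDiff [CharZero K] (H : BracketHomotopy L) : L.brDiff * L.brDiff = 0 := by
  have h₁ : L.brDiff = H.op * L.diff - L.diff * H.op := by rw [H.op_mul_diff]; abel
  have h₂ : L.brDiff * L.brDiff = -(L.brDiff * L.brDiff) := by
    calc L.brDiff * L.brDiff = L.brDiff * H.op * L.diff - L.brDiff * L.diff * H.op := by
          nth_rw 2 [h₁]; rw [mul_sub, mul_assoc, mul_assoc]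
      _ = -(H.op * L.diff - L.diff * H.op) * L.brDiff := by
          rw [← H.op_mul_brDiff, mul_assoc, ← neg_eq_iff_eq_neg.2 H.diff_mul_brDiff, neg_mul,
            neg_mul, sub_mul, mul_assoc, mul_assoc, mul_assoc, H.op_mul_brDiff, mul_neg]
          abel
      _ = -(L.brDiff * L.brDiff) := by rw [← h₁, neg_mul]
  have h₃ : (2 : K) • (L.brDiff * L.brDiff) = 0 := by
    rw [two_smul]
    nth_rw 1 [h₂]
    exact neg_add_cancel _
  exact (smul_eq_zero.1 h₃).resolve_left two_ne_zero

end BracketHomotopy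

/-! ### Parity, augmentation and linear part -/

namespace SuperSym

section
variable (L : DGLA.{u, w} K)

theorem parity_comm {i j : ℤ} (a : L i) (b : L j) :
    ((i + 1).negOnePow • gen i : L i →ₗ[K] SuperSym L) a * ((j + 1).negOnePow • gen j) b =
      ((i + 1) * (j + 1)).negOnePow •
        (((j + 1).negOnePow • gen j) b * ((i + 1).negOnePow • gen i) a) := by
  simp only [LinearMap.smul_apply, smul_mul_assoc, mul_smul_comm]
  rw [gen_mul_gen a b]
  simp only [smul_smul]
  congr 1
  ac_rfl

/-- The parity automorphism, with sign `(-1)^{|a| + 1}` on the generator of `a`. -/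
noncomputable def parity : SuperSym L →ₐ[K] SuperSym L :=
  lift (fun i => (i + 1).negOnePow • gen i) (parity_comm L)

theorem parity_gen {i : ℤ} (a : L i) : parity L (gen i a) = (i + 1).negOnePow • gen i a :=
  lift_gen _ (parity_comm L) a

theorem parity_mul_mulGen {i : ℤ} (a : L i) :
    (parity L).toLinearMap * mulGen i a =
      (i + 1).negOnePow • (mulGen i a * (parity L).toLinearMap) := by
  ext s
  change parity L (gen i a * s) = (i + 1).negOnePow • (gen i a * parity L s)
  rw [map_mul, parity_gen, smul_mul_assoc]

/-- An operator has the parity `p` as soon as its supercommutators with the generators have the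
corresponding parities. -/
theorem HasCommutator.parity_mul {L : DGLA.{u, w} K} {p : ℤ}
    {x : ∀ i, L i →ₗ[K] Module.End K (SuperSym L)} {X : Module.End K (SuperSym L)}
    (hX : HasCommutator p x X)
    (hx : ∀ {i : ℤ} (a : L i), (parity L).toLinearMap * x i a =
      (p + (i + 1)).negOnePow • (x i a * (parity L).toLinearMap)) :
    (parity L).toLinearMap * X = p.negOnePow • (X * (parity L).toLinearMap) := by
  rw [← sub_eq_zero]
  refine eq_zero_of_mul_mulGen ?_ (fun {i} a => ⟨(p * (i + 1) + (i + 1)).negOnePow, ?_⟩)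
  · change parity L (X 1) - (p.negOnePow • X (parity L 1)) = 0
    rw [map_one (parity L), hX.apply_one, map_zero (parity L)]
    simp
  · have h := parity_mul_mulGen L a
    rw [sub_mul, mul_assoc, hX.mul_mulGen, smul_mul_assoc, mul_assoc, h, mul_smul_comm, mul_add, hx,
      mul_smul_comm, ← mul_assoc, ← mul_assoc, h, hX.mul_mulGen, mul_sub, mul_smul_comm, add_mul]
    simp only [smul_add, smul_sub, smul_smul, Int.negOnePow_add, smul_mul_assoc, mul_assoc]
    rw [mul_left_comm p.negOnePow]
    rcases Int.units_eq_one_or p.negOnePow with hp | hp <;>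
    rcases Int.units_eq_one_or i.negOnePow with hi | hi <;>
    rcases Int.units_eq_one_or (p * (i + 1)).negOnePow with hq | hq <;>
    · rw [hp, hi, hq]
      simp

/-- The augmentation, sending the generators to `0`. -/
noncomputable def aug : SuperSym L →ₐ[K] K := lift (fun _ => 0) (by simp)

theorem aug_gen {i : ℤ} (a : L i) : aug L (gen i a) = 0 :=
  lift_gen (fun i => (0 : L i →ₗ[K] K)) (by simp) a

theorem aug_gen_mul {i : ℤ} (a : L i) (s : SuperSym L) : aug L (gen i a * s) = 0 := by
  rw [map_mul, aug_gen, zero_mul]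

theorem HasCommutator.aug_apply {L : DGLA.{u, w} K} {p : ℤ}
    {x : ∀ i, L i →ₗ[K] Module.End K (SuperSym L)} {X : Module.End K (SuperSym L)}
    (hX : HasCommutator p x X) (hx : ∀ {i : ℤ} (a : L i) (s : SuperSym L), aug L (x i a s) = 0)
    (s : SuperSym L) : aug L (X s) = 0 := by
  induction s using SuperSym.induction with
  | one => rw [hX.apply_one, map_zero]
  | gen_mul i a s hs =>
    refine (congrArg (aug L) (LinearMap.congr_fun (hX.mul_mulGen a) s)).trans ?_
    rw [LinearMap.add_apply, map_add, hx, zero_add]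
    change aug L ((p * (i + 1)).negOnePow • (gen i a * X s)) = 0
    rw [map_units_smul', aug_gen_mul]
    simp
  | add s t hs ht => rw [map_add, map_add, hs, ht, add_zero]
  | smul c s hs => rw [map_smul, map_smul, hs, smul_zero]

theorem aug_parity (s : SuperSym L) : aug L (parity L s) = aug L s := by
  induction s using SuperSym.induction with
  | one => simp
  | gen_mul i a s hs =>
    rw [aug_gen_mul, map_mul, parity_gen, smul_mul_assoc, map_units_smul', aug_gen_mul]
    simp
  | add s t hs ht => rw [map_add, map_add, map_add, hs, ht]
  | smul c s hs => rw [map_smul, map_smul, map_smul, hs]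

/-- The projection of a homogeneous element to the component of degree `j`. -/
def toComp (i j : ℤ) : L i →ₗ[K] L j :=
  if h : i = j then (L.castDeg h).toLinearMap else 0

/-- The nilpotent action `(c, x) ↦ (0, c a)` of the generator of `a` on `K × L j`, with `a`
replaced by its component of degree `j`. -/
noncomputable def linearPartGen (i j : ℤ) : L i →ₗ[K] Module.End K (K × L j) where
  toFun a := LinearMap.inr K K (L j) ∘ₗ (LinearMap.fst K K (L j)).smulRight (toComp L i j a)
  map_add' a b := by
    refine LinearMap.ext fun s => Prod.ext ?_ ?_ <;> simp
  map_smul' c a := by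
    refine LinearMap.ext fun s => Prod.ext ?_ ?_
    · simp
    · simp [smul_comm c]

theorem linearPartGen_comm (j : ℤ) {m n : ℤ} (a : L m) (b : L n) :
    linearPartGen L m j a * linearPartGen L n j b =
      ((m + 1) * (n + 1)).negOnePow • (linearPartGen L n j b * linearPartGen L m j a) := by
  have h {m n : ℤ} (x : L m) (y : L n) : linearPartGen L m j x * linearPartGen L n j y = 0 := by
    refine LinearMap.ext fun s => Prod.ext ?_ ?_ <;> simp [linearPartGen]
  rw [h, h, smul_zero]

/-- The action of the supersymmetric algebra on `K × L j` extending `linearPartGen`; products of two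
generators act by zero. -/
noncomputable def linearPartAction (j : ℤ) : SuperSym L →ₐ[K] Module.End K (K × L j) :=
  lift (fun i => linearPartGen L i j) (linearPartGen_comm L j)

theorem linearPartAction_gen (i j : ℤ) (a : L i) :
    linearPartAction L j (gen i a) = linearPartGen L i j a :=
  lift_gen _ (linearPartGen_comm L j) a

/-- The component in `L j` of the linear part of an element, as a matrix coefficient of
`linearPartAction`. -/
noncomputable def linearPart (j : ℤ) : SuperSym L →ₗ[K] L j :=
  LinearMap.snd K _ _ ∘ₗ LinearMap.applyₗ (1, 0) ∘ₗ (linearPartAction L j).toLinearMap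

theorem linearPart_one (j : ℤ) : linearPart L j 1 = 0 := by
  change (linearPartAction L j 1 (1, 0)).2 = 0
  rw [map_one]
  rfl

theorem linearPart_gen_mul (i j : ℤ) (a : L i) (s : SuperSym L) :
    linearPart L j (gen i a * s) = aug L s • toComp L i j a := by
  have h (s : SuperSym L) : linearPartAction L j (gen i a * s) (1, 0) =
      linearPartGen L i j a (linearPartAction L j s (1, 0)) := by
    rw [map_mul, linearPartAction_gen]
    rfl
  have h' (s : SuperSym L) : (linearPartAction L j s (1, 0)).1 = aug L s := by
    induction s using SuperSym.induction with
    | one => rw [map_one, map_one]; rfl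
    | gen_mul i a s hs =>
      rw [map_mul, linearPartAction_gen, aug_gen_mul]
      rfl
    | add s t hs ht => rw [map_add, LinearMap.add_apply, Prod.fst_add, hs, ht, map_add]
    | smul c s hs => rw [map_smul, LinearMap.smul_apply, Prod.smul_fst, hs, map_smul]
  change (linearPartAction L j (gen i a * s) (1, 0)).2 = _
  rw [h, ← h']
  rfl

theorem linearPart_gen {j : ℤ} (a : L j) : linearPart L j (gen j a) = a := by
  have := linearPart_gen_mul L j j a 1
  rw [mul_one, map_one, one_smul] at this
  rw [this, toComp, dif_pos rfl]
  rfl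

theorem toComp_d {i i' j j' : ℤ} (h : i + 1 = i') (h' : j + 1 = j') (a : L i) :
    toComp L i' j' (L.d h a) = L.d h' (toComp L i j a) := by
  by_cases e : i = j
  · subst e h h'
    simp [toComp]
  · rw [toComp, toComp, dif_neg e, dif_neg (by omega)]
    simp

end

end SuperSym

section
variable (L : DGLA.{u, w} K)

theorem diff_gen_mul {i j : ℤ} (h : i + 1 = j) (a : L i) (s : SuperSym L) :
    L.diff (gen i a * s) = -(gen j (L.d h a) * s) + (i + 1).negOnePow • (gen i a * L.diff s) :=
  LinearMap.congr_fun (L.diff_mul_mulGen h a) s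

theorem aug_diff (s : SuperSym L) : aug L (L.diff s) = 0 :=
  L.exists_diff.choose_spec.aug_apply (fun _ _ => aug_gen_mul _ _ _) s

theorem aug_lieDer {i : ℤ} (a : L i) (s : SuperSym L) : aug L (L.lieDer i a s) = 0 :=
  (L.exists_lieDer a).choose_spec.aug_apply (fun _ _ => aug_gen_mul _ _ _) s

theorem aug_brDiff (s : SuperSym L) : aug L (L.brDiff s) = 0 :=
  L.exists_brDiff.choose_spec.aug_apply (fun _ _ => aug_lieDer _ _ _) s

/-- Up to sign, taking linear parts is a morphism of complexes from the chains with `diff`. -/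
theorem linearPart_diff {i j : ℤ} (h : i + 1 = j) (s : SuperSym L) :
    linearPart L j (L.diff s) = -L.d h (linearPart L i s) := by
  induction s using SuperSym.induction with
  | one => simp [diff_one, linearPart_one]
  | gen_mul m a s hs =>
    rw [L.diff_gen_mul rfl, map_add, map_neg, map_units_smul', linearPart_gen_mul,
      linearPart_gen_mul, linearPart_gen_mul, aug_diff, toComp_d L rfl h, map_smul]
    simp
  | add s t hs ht => simp only [map_add, hs, ht, neg_add]
  | smul c s hs => simp only [map_smul, hs, smul_neg]

theorem parity_mul_diff : (parity L).toLinearMap * L.diff = -(L.diff * (parity L).toLinearMap) := by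
  refine (L.exists_diff.choose_spec.parity_mul fun {i} a => ?_).trans ?_
  · refine (parity_mul_mulGen L _).trans ?_
    rw [add_comm 1]
    rfl
  · rw [Int.negOnePow_one, Units.neg_smul, one_smul]
    rfl

theorem parity_mul_lieDer {i : ℤ} (a : L i) : (parity L).toLinearMap * L.lieDer i a =
    i.negOnePow • (L.lieDer i a * (parity L).toLinearMap) :=
  (L.exists_lieDer a).choose_spec.parity_mul fun {j} b => by
    refine (parity_mul_mulGen L _).trans ?_
    rw [add_assoc]
    rfl

theorem parity_mul_brDiff :
    (parity L).toLinearMap * L.brDiff = -(L.brDiff * (parity L).toLinearMap) := by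
  refine (L.exists_brDiff.choose_spec.parity_mul fun {i} a => ?_).trans ?_
  · rw [parity_mul_lieDer, (Int.negOnePow_eq_iff i (1 + (i + 1))).2 ⟨-1, by ring⟩]
  · rw [Int.negOnePow_one, Units.neg_smul, one_smul]
    rfl

end

/-! ### Word length -/

namespace SuperSym

variable (L : DGLA.{u, w} K)

/-- The span of the products of at most `n` generators, defined recursively. -/
noncomputable def wordFiltration : ℕ → Submodule K (SuperSym L)
  | 0 => Submodule.span K {1}
  | n + 1 => wordFiltration n ⊔
      Submodule.span K {x | ∃ (i : ℤ) (a : L i), ∃ s ∈ wordFiltration n, gen i a * s = x}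

variable {L}

theorem wordFiltration_le_succ (n : ℕ) : wordFiltration L n ≤ wordFiltration L (n + 1) :=
  le_sup_left

theorem gen_mul_mem_wordFiltration {n : ℕ} {i : ℤ} (a : L i) {s : SuperSym L}
    (hs : s ∈ wordFiltration L n) : gen i a * s ∈ wordFiltration L (n + 1) :=
  Submodule.mem_sup_right (Submodule.subset_span ⟨i, a, s, hs, rfl⟩)

theorem wordFiltration_mono : Monotone (wordFiltration L) :=
  monotone_nat_of_le_succ wordFiltration_le_succ

theorem exists_mem_wordFiltration (s : SuperSym L) : ∃ n, s ∈ wordFiltration L n := by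
  induction s using SuperSym.induction with
  | one => exact ⟨0, Submodule.mem_span_singleton_self 1⟩
  | gen_mul i a s hs =>
    obtain ⟨n, hn⟩ := hs
    exact ⟨n + 1, gen_mul_mem_wordFiltration a hn⟩
  | add s t hs ht =>
    obtain ⟨m, hm⟩ := hs
    obtain ⟨n, hn⟩ := ht
    exact ⟨max m n, add_mem (wordFiltration_mono (le_max_left m n) hm)
      (wordFiltration_mono (le_max_right m n) hn)⟩
  | smul c s hs =>
    obtain ⟨n, hn⟩ := hs
    exact ⟨n, Submodule.smul_mem _ c hn⟩

/-- To bound a linear map on a step of the word filtration it is enough to consider the previous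
step and the products with a generator. -/
theorem wordFiltration_succ_le {n : ℕ} {S : Submodule K (SuperSym L)} (h₁ : wordFiltration L n ≤ S)
    (h₂ : ∀ (i : ℤ) (a : L i), ∀ s ∈ wordFiltration L n, gen i a * s ∈ S) :
    wordFiltration L (n + 1) ≤ S := by
  refine sup_le h₁ (Submodule.span_le.2 ?_)
  rintro _ ⟨i, a, s, hs, rfl⟩
  exact h₂ i a s hs

end SuperSym

namespace BracketHomotopy

variable {L : DGLA.{u, w} K} (H : BracketHomotopy L)

theorem der_mem_wordFiltration {i : ℤ} (a : L i) (n : ℕ) :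
    wordFiltration L n ≤ (wordFiltration L n).comap (H.der i a) := by
  induction n with
  | zero =>
    refine Submodule.span_le.2 (Set.singleton_subset_iff.2 ?_)
    change H.der i a 1 ∈ wordFiltration L 0
    rw [H.der_one]
    exact zero_mem _
  | succ n ih =>
    refine wordFiltration_succ_le (fun s hs => wordFiltration_le_succ n (ih hs)) ?_
    intro j b s hs
    have h : H.der i a (gen j b * s) = _ := LinearMap.congr_fun (H.der_mul_mulGen rfl a b) s
    change H.der i a (gen j b * s) ∈ wordFiltration L (n + 1)
    rw [h]
    exact add_mem (units_smul_mem _ (gen_mul_mem_wordFiltration _ hs))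
      (units_smul_mem _ (gen_mul_mem_wordFiltration _ (ih hs)))

theorem op_gen_mul {i : ℤ} (a : L i) (s : SuperSym L) :
    H.op (gen i a * s) = H.der i a s + gen i a * H.op s :=
  LinearMap.congr_fun (H.op_mul_mulGen a) s

theorem op_eq_zero : wordFiltration L 0 ≤ LinearMap.ker H.op :=
  Submodule.span_le.2 (Set.singleton_subset_iff.2 H.op_one)

/-- The operator `op` replaces two factors of a product by one, so it lowers the word length. -/
theorem op_mem_wordFiltration (n : ℕ) :
    wordFiltration L (n + 1) ≤ (wordFiltration L n).comap H.op := by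
  induction n with
  | zero =>
    refine wordFiltration_succ_le (fun s hs => ?_) fun i a s hs => ?_
    · change H.op s ∈ wordFiltration L 0
      rw [show H.op s = 0 from H.op_eq_zero hs]
      exact zero_mem _
    · change H.op (gen i a * s) ∈ wordFiltration L 0
      rw [op_gen_mul, show H.op s = 0 from H.op_eq_zero hs, mul_zero, add_zero]
      exact H.der_mem_wordFiltration a 0 hs
  | succ n ih =>
    refine wordFiltration_succ_le (fun s hs => wordFiltration_le_succ n (ih hs)) fun i a s hs => ?_
    change H.op (gen i a * s) ∈ wordFiltration L (n + 1)
    rw [op_gen_mul]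
    exact add_mem (H.der_mem_wordFiltration a _ hs) (gen_mul_mem_wordFiltration a (ih hs))

theorem op_pow_apply_eq_zero (n : ℕ) : ∀ s ∈ wordFiltration L n, (H.op ^ (n + 1)) s = 0 := by
  induction n with
  | zero =>
    intro s hs
    rw [zero_add, pow_one]
    exact H.op_eq_zero hs
  | succ n ih =>
    intro s hs
    rw [pow_succ]
    exact ih _ (H.op_mem_wordFiltration n hs)

/-- `[op ^ n, diff] = n op ^ (n - 1) brDiff`. -/
theorem op_pow_mul_diff (n : ℕ) : H.op ^ (n + 1) * L.diff =
    L.diff * H.op ^ (n + 1) + (n + 1) • (H.op ^ n * L.brDiff) := by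
  induction n with
  | zero => simpa using H.op_mul_diff
  | succ n ih =>
    have h : ∀ m, H.op ^ m * L.brDiff = L.brDiff * H.op ^ m := fun m =>
      (show Commute H.op L.brDiff from H.op_mul_brDiff).pow_left m
    rw [pow_succ', mul_assoc, ih, mul_add, ← mul_assoc, H.op_mul_diff, mul_smul_comm,
      ← mul_assoc, ← pow_succ', add_mul, mul_assoc, ← pow_succ', ← h, add_assoc,
      add_smul (n + 1) 1, one_smul, add_comm (H.op ^ (n + 1) * L.brDiff)]

/-! ### The exponential of the homotopy -/

/-- The partial sums of `exp (-op)` intertwine `diff + brDiff` and `diff` up to one term. -/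
theorem diff_sum_op_pow [CharZero K] (s : SuperSym L) (m : ℕ) :
    L.diff (∑ n ∈ Finset.range (m + 1), ((-1) ^ n / (n.factorial : K)) • (H.op ^ n) s) =
      ∑ n ∈ Finset.range (m + 1),
        ((-1) ^ n / (n.factorial : K)) • (H.op ^ n) ((L.diff + L.brDiff) s) -
      ((-1) ^ m / (m.factorial : K)) • (H.op ^ m) (L.brDiff s) := by
  induction m with
  | zero => simp
  | succ m ih =>
    have h : (H.op ^ (m + 1)) (L.diff s) =
        L.diff ((H.op ^ (m + 1)) s) + (m + 1) • (H.op ^ m) (L.brDiff s) :=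
      LinearMap.congr_fun (H.op_pow_mul_diff m) s
    rw [Finset.sum_range_succ, map_add, ih, Finset.sum_range_succ _ (m + 1), map_smul,
      LinearMap.add_apply, map_add, h]
    have hm : ((m + 1 : ℕ) : K) ≠ 0 := by exact_mod_cast m.succ_ne_zero
    have hc : ((-1) ^ (m + 1) / ((m + 1).factorial : K)) • ((m + 1) • (H.op ^ m) (L.brDiff s)) =
        -(((-1) ^ m / (m.factorial : K)) • (H.op ^ m) (L.brDiff s)) := by
      rw [← Nat.cast_smul_eq_nsmul K, smul_smul, ← neg_smul, Nat.factorial_succ]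
      congr 1
      have : (m.factorial : K) ≠ 0 := by exact_mod_cast m.factorial_ne_zero
      push_cast at hm ⊢
      field_simp
      ring
    rw [smul_add, smul_add, hc]
    abel

/-- A generator that is exact for `diff + brDiff` is exact for `diff`. -/
theorem exists_diff_eq_gen [CharZero K] (H : BracketHomotopy L) {j : ℤ} (a : L j) (s : SuperSym L)
    (hs : (L.diff + L.brDiff) s = gen j a) : ∃ y, L.diff y = gen j a := by
  obtain ⟨n, hn⟩ := exists_mem_wordFiltration s
  -- the sum is `exp (-op) s`, as `op ^ (n + 1)` kills `s`
  refine ⟨_, (H.diff_sum_op_pow s (n + 1)).trans ?_⟩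
  have h₁ : (H.op ^ (n + 1)) (L.brDiff s) = L.brDiff ((H.op ^ (n + 1)) s) :=
    LinearMap.congr_fun
      ((show Commute H.op L.brDiff from H.op_mul_brDiff).pow_left (n + 1)) s
  have h₂ : H.op (gen j a) = 0 := by
    have := H.op_gen_mul a 1
    rwa [mul_one, H.der_one, H.op_one, mul_zero, add_zero] at this
  rw [h₁, H.op_pow_apply_eq_zero n s hn, map_zero, smul_zero, sub_zero, hs, Finset.sum_range_succ']
  have h₃ : ∀ m, (H.op ^ (m + 1)) (gen j a) = 0 := fun m => by
    rw [pow_succ]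
    exact (congrArg (H.op ^ m) h₂).trans (map_zero _)
  simp [h₃]

/-- The supersymmetric algebra of `L[1]`, with the Chevalley-Eilenberg differential, as a Cartan
module. -/
noncomputable def cartanModule [CharZero K] (H : BracketHomotopy L) :
    CartanModule L (SuperSym L) where
  P := (parity L).toLinearMap
  Q := L.diff + L.brDiff
  one := 1
  aug := (aug L).toLinearMap
  ι := mulGen
  ρ := L.lieDer
  P_mul_Q := by
    rw [mul_add, add_mul, parity_mul_diff, parity_mul_brDiff]
    abel
  Q_mul_Q := by
    rw [mul_add, add_mul, add_mul, L.diff_mul_diff, H.brDiff_mul_brDiff, H.diff_mul_brDiff]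
    abel
  P_one := map_one (parity L)
  Q_one := by simp [diff_one, brDiff_one]
  aug_one := map_one (aug L)
  aug_P := aug_parity L
  aug_Q s := (map_add (aug L) _ _).trans (by rw [aug_diff, aug_brDiff, add_zero])
  P_mul_ι := parity_mul_mulGen L
  Q_mul_ι h a := by
    rw [add_mul, L.diff_mul_mulGen h, L.brDiff_mul_mulGen, mul_add, smul_add]
    abel
  ι_mul_ι := mulGen_mul_mulGen
  ρ_mul_ι := L.lieDer_mul_mulGen
  ρ_one := L.lieDer_one

/-- A DGLA whose bracket has a null homotopy satisfying the cyclic identity is homotopy abelian. -/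
theorem isHomotopyAbelian [CharZero K] (H : BracketHomotopy L) : L.IsHomotopyAbelian := by
  refine H.cartanModule.isHomotopyAbelian fun {i j} h a _ hs => ?_
  obtain ⟨s, hs⟩ := hs
  obtain ⟨y, hy⟩ := H.exists_diff_eq_gen a s (hs.trans (mul_one _))
  refine ⟨-linearPart L i y, ?_⟩
  rw [map_neg, ← linearPart_diff, hy, linearPart_gen]

end BracketHomotopy

/-! ### Bracket homotopies on subalgebras, products and polynomial forms -/

namespace BracketHomotopy

/-- The restriction of the bilinear map of a bracket homotopy to a subalgebra closed under it. -/
def subMap {L : DGLA.{u, w} K} (H : BracketHomotopy L) (M : L.Sub)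
    (hM : ∀ {i j k : ℤ} (h : i + j - 1 = k) {a : L i} {b : L j},
      a ∈ M.carrier i → b ∈ M.carrier j → H.h h a b ∈ M.carrier k)
    {i j k : ℤ} (h : i + j - 1 = k) : M.carrier i →ₗ[K] M.carrier j →ₗ[K] M.carrier k :=
  LinearMap.mk₂ K
    (fun (a : M.carrier i) (b : M.carrier j) =>
      (⟨H.h h a.1 b.1, hM h a.2 b.2⟩ : M.carrier k))
    (fun _ _ _ => Subtype.ext (by simp))
    (fun _ _ _ => Subtype.ext (by simp))
    (fun _ _ _ => Subtype.ext (by simp))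
    (fun _ _ _ => Subtype.ext (by simp))

/-- The restriction of a bracket homotopy to a subalgebra closed under it. -/
def sub {L : DGLA.{u, w} K} (H : BracketHomotopy L) (M : L.Sub)
    (hM : ∀ {i j k : ℤ} (h : i + j - 1 = k) {a : L i} {b : L j},
      a ∈ M.carrier i → b ∈ M.carrier j → H.h h a b ∈ M.carrier k) :
    BracketHomotopy M.toDGLA where
  h h := H.subMap M hM h
  antisymm hij hji a b := Subtype.ext (H.antisymm hij hji a.1 b.1)
  homotopy hij hn hk hi hj h₁ h₂ a b :=
    Subtype.ext (H.homotopy hij hn hk hi hj h₁ h₂ a.1 b.1)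
  cyclic hij hjk hki h₁ h₂ h₃ hij' hjk' hki' h₁' h₂' h₃' a b c :=
    Subtype.ext (H.cyclic hij hjk hki h₁ h₂ h₃ hij' hjk' hki' h₁' h₂' h₃' a.1 b.1 c.1)

/-- The componentwise bilinear map on a product. -/
def prodMap {L : DGLA.{u, w} K} {M : DGLA.{u, w'} K} (H : BracketHomotopy L)
    (H' : BracketHomotopy M) {i j k : ℤ} (h : i + j - 1 = k) :
    L i × M i →ₗ[K] L j × M j →ₗ[K] L k × M k :=
  LinearMap.mk₂ K
    (fun (a : L i × M i) (b : L j × M j) => ((H.h h a.1 b.1, H'.h h a.2 b.2) : L k × M k))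
    (fun _ _ _ => Prod.ext (by simp) (by simp))
    (fun _ _ _ => Prod.ext (by simp) (by simp))
    (fun _ _ _ => Prod.ext (by simp) (by simp))
    (fun _ _ _ => Prod.ext (by simp) (by simp))

/-- The componentwise bracket homotopy on a product. -/
def prod {L : DGLA.{u, w} K} {M : DGLA.{u, w'} K} (H : BracketHomotopy L)
    (H' : BracketHomotopy M) : BracketHomotopy (L.prod M) where
  h h := H.prodMap H' h
  antisymm hij hji a b :=
    Prod.ext (H.antisymm hij hji a.1 b.1) (H'.antisymm hij hji a.2 b.2)
  homotopy hij hn hk hi hj h₁ h₂ a b :=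
    Prod.ext (H.homotopy hij hn hk hi hj h₁ h₂ a.1 b.1)
      (H'.homotopy hij hn hk hi hj h₁ h₂ a.2 b.2)
  cyclic hij hjk hki h₁ h₂ h₃ hij' hjk' hki' h₁' h₂' h₃' a b c :=
    Prod.ext (H.cyclic hij hjk hki h₁ h₂ h₃ hij' hjk' hki' h₁' h₂' h₃' a.1 b.1 c.1)
      (H'.cyclic hij hjk hki h₁ h₂ h₃ hij' hjk' hki' h₁' h₂' h₃' a.2 b.2 c.2)

variable {L : DGLA.{u, w} K} (H : BracketHomotopy L)

/-- The extension of a bracket homotopy to `K[t] ⊗ L`: `(p ⊗ a, q ⊗ b) ↦ pq ⊗ h(a, b)`. -/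
noncomputable def poly {i j k : ℤ} (h : i + j - 1 = k) :
    K[X] ⊗[K] L i →ₗ[K] K[X] ⊗[K] L j →ₗ[K] K[X] ⊗[K] L k :=
  TensorProduct.map₂ (LinearMap.mul K K[X]) (H.h h)

@[simp] theorem poly_tmul {i j k : ℤ} (h : i + j - 1 = k) (p q : K[X]) (a : L i) (b : L j) :
    H.poly h (p ⊗ₜ a) (q ⊗ₜ b) = (p * q) ⊗ₜ H.h h a b := rfl

theorem poly_antisymm {i j k : ℤ} (hij : i + j - 1 = k) (hji : j + i - 1 = k)
    (x : K[X] ⊗[K] L i) (y : K[X] ⊗[K] L j) :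
    H.poly hij x y = -((i * j).negOnePow • H.poly hji y x) := by
  induction x with
  | zero => simp
  | add x y hx hy => simp [hx, hy]; abel
  | tmul p a =>
    induction y with
    | zero => simp
    | add x y hx hy => simp [hx, hy]; abel
    | tmul q b =>
      rw [poly_tmul, poly_tmul, H.antisymm hij hji, mul_comm]
      rcases Int.even_or_odd (i * j) with h | h <;>
        simp [Int.negOnePow_even, Int.negOnePow_odd, h, TensorProduct.tmul_neg]

theorem poly_homotopy {i j k n i' j' : ℤ} (hij : i + j = k) (hn : i + j - 1 = n) (hk : n + 1 = k)
    (hi : i + 1 = i') (hj : j + 1 = j') (h₁ : i' + j - 1 = k) (h₂ : i + j' - 1 = k)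
    (x : K[X] ⊗[K] L i) (y : K[X] ⊗[K] L j) :
    L.polyBr hij x y = L.polyD hk (H.poly hn x y) + H.poly h₁ (L.polyD hi x) y +
      i.negOnePow • H.poly h₂ x (L.polyD hj y) := by
  induction x with
  | zero => simp
  | add x y hx hy => simp [hx, hy]; abel
  | tmul p a =>
    induction y with
    | zero => simp
    | add x y hx hy => simp [hx, hy]; abel
    | tmul q b =>
      simp only [polyBr_tmul, polyD_tmul, poly_tmul]
      rw [H.homotopy hij hn hk hi hj h₁ h₂]
      rcases Int.even_or_odd i with h | h <;>
        simp [Int.negOnePow_even, Int.negOnePow_odd, h, TensorProduct.tmul_add,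
          TensorProduct.tmul_neg]

theorem polyDeriv_poly {i j k i' j' k' : ℤ} (hi : i = i') (hj : j = j') (hk : k = k')
    (h : i + j - 1 = k) (h₁ : i' + j - 1 = k') (h₂ : i + j' - 1 = k')
    (x : K[X] ⊗[K] L i) (y : K[X] ⊗[K] L j) :
    L.polyDeriv hk (H.poly h x y) =
      H.poly h₁ (L.polyDeriv hi x) y + H.poly h₂ x (L.polyDeriv hj y) := by
  subst hi hj hk
  induction x with
  | zero => simp
  | add x y hx hy => simp [hx, hy]; abel
  | tmul p a =>
    induction y with
    | zero => simp
    | add x y hx hy => simp [hx, hy]; abel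
    | tmul q b => simp [TensorProduct.add_tmul]

theorem poly_cyclic {i j k n ij jk ki ij' jk' ki' : ℤ} (hij : i + j - 1 = ij)
    (hjk : j + k - 1 = jk) (hki : k + i - 1 = ki) (h₁ : ij + k = n) (h₂ : jk + i = n)
    (h₃ : ki + j = n) (hij' : i + j = ij') (hjk' : j + k = jk') (hki' : k + i = ki')
    (h₁' : ij' + k - 1 = n) (h₂' : jk' + i - 1 = n) (h₃' : ki' + j - 1 = n)
    (x : K[X] ⊗[K] L i) (y : K[X] ⊗[K] L j) (z : K[X] ⊗[K] L k) :
    (L.polyBr h₁ (H.poly hij x y) z +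
      (i * (j + k)).negOnePow • L.polyBr h₂ (H.poly hjk y z) x +
      (k * (i + j)).negOnePow • L.polyBr h₃ (H.poly hki z x) y) +
    (H.poly h₁' (L.polyBr hij' x y) z +
      (i * (j + k)).negOnePow • H.poly h₂' (L.polyBr hjk' y z) x +
      (k * (i + j)).negOnePow • H.poly h₃' (L.polyBr hki' z x) y) = 0 := by
  induction x with
  | zero => simp
  | add x x' hx hx' =>
    have := congrArg₂ (· + ·) hx hx'
    simp only [map_add, LinearMap.add_apply, smul_add, add_zero] at this ⊢
    rw [← this]; abel
  | tmul p a =>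
    induction y with
    | zero => simp
    | add x x' hx hx' =>
      have := congrArg₂ (· + ·) hx hx'
      simp only [map_add, LinearMap.add_apply, smul_add, add_zero] at this ⊢
      rw [← this]; abel
    | tmul q b =>
      induction z with
      | zero => simp
      | add x x' hx hx' =>
        have := congrArg₂ (· + ·) hx hx'
        simp only [map_add, LinearMap.add_apply, smul_add, add_zero] at this ⊢
        rw [← this]; abel
      | tmul r c =>
        have key := congrArg (fun v => (p * q * r) ⊗ₜ[K] v)
          (H.cyclic hij hjk hki h₁ h₂ h₃ hij' hjk' hki' h₁' h₂' h₃' a b c)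
        simp only [polyBr_tmul, poly_tmul]
        rw [show q * r * p = p * q * r by ring, show r * p * q = p * q * r by ring]
        rcases Int.even_or_odd (i * (j + k)) with h | h <;>
        rcases Int.even_or_odd (k * (i + j)) with h' | h' <;>
        simpa [Int.negOnePow_even, Int.negOnePow_odd, h, h', TensorProduct.tmul_add,
          TensorProduct.tmul_neg] using key

theorem polyEval_poly (s : K) {i j k : ℤ} (h : i + j - 1 = k) (x : K[X] ⊗[K] L i)
    (y : K[X] ⊗[K] L j) :
    L.polyEval s k (H.poly h x y) = H.h h (L.polyEval s i x) (L.polyEval s j y) := by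
  induction x with
  | zero => simp
  | add x y hx hy => simp [hx, hy]
  | tmul p a =>
    induction y with
    | zero => simp
    | add x y hx hy => simp [hx, hy]
    | tmul q b => simp [smul_smul, mul_comm]

/-- The extension of a bracket homotopy to polynomial forms on pairs, following the Koszul rule
`h(u ⊗ a, v ⊗ b) = (-1)^{|u| + |v| + |a||v|} uv ⊗ h(a, b)`, with pairs as in `polyForms`. -/
noncomputable def polyFormsMap {i j k : ℤ} (h : i + j - 1 = k) :
    ((K[X] ⊗[K] L i) × (K[X] ⊗[K] L (i - 1))) →ₗ[K]
      ((K[X] ⊗[K] L j) × (K[X] ⊗[K] L (j - 1))) →ₗ[K]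
        ((K[X] ⊗[K] L k) × (K[X] ⊗[K] L (k - 1))) :=
  LinearMap.mk₂ K
    (fun x y =>
      (H.poly h x.1 y.1, -H.poly (by omega) x.2 y.1 - i.negOnePow • H.poly (by omega) x.1 y.2))
    (fun _ _ _ => Prod.ext (by simp) (by simp; abel))
    (fun _ _ _ => Prod.ext (by simp) (by simp [smul_comm i.negOnePow, smul_sub]))
    (fun _ _ _ => Prod.ext (by simp) (by simp; abel))
    (fun _ _ _ => Prod.ext (by simp) (by simp [smul_comm i.negOnePow, smul_sub]))

theorem polyFormsMap_apply {i j k : ℤ} (h : i + j - 1 = k)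
    (x : (K[X] ⊗[K] L i) × (K[X] ⊗[K] L (i - 1)))
    (y : (K[X] ⊗[K] L j) × (K[X] ⊗[K] L (j - 1))) :
    H.polyFormsMap h x y = (H.poly h x.1 y.1,
      -H.poly (by omega) x.2 y.1 - i.negOnePow • H.poly (by omega) x.1 y.2) := rfl

theorem polyFormsMap_antisymm {i j k : ℤ} (hij : i + j - 1 = k) (hji : j + i - 1 = k)
    (x : (K[X] ⊗[K] L i) × (K[X] ⊗[K] L (i - 1)))
    (y : (K[X] ⊗[K] L j) × (K[X] ⊗[K] L (j - 1))) :
    H.polyFormsMap hij x y = -((i * j).negOnePow • H.polyFormsMap hji y x) := by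
  refine Prod.ext (H.poly_antisymm hij hji x.1 y.1) ?_
  simp only [polyFormsMap_apply, Prod.snd_neg, Prod.smul_snd]
  rw [H.poly_antisymm (by omega) (by omega) x.2 y.1,
    H.poly_antisymm (by omega) (by omega) x.1 y.2]
  simp only [smul_sub, smul_neg, smul_smul, ← Int.negOnePow_add]
  rw [show i + i * (j - 1) = i * j by ring, (Int.negOnePow_eq_iff (i * j + j) ((i - 1) * j)).2
    ⟨j, by ring⟩]
  abel

theorem polyFormsMap_homotopy {i j k n i' j' : ℤ} (hij : i + j = k) (hn : i + j - 1 = n)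
    (hk : n + 1 = k) (hi : i + 1 = i') (hj : j + 1 = j') (h₁ : i' + j - 1 = k) (h₂ : i + j' - 1 = k)
    (x : (K[X] ⊗[K] L i) × (K[X] ⊗[K] L (i - 1)))
    (y : (K[X] ⊗[K] L j) × (K[X] ⊗[K] L (j - 1))) :
    L.polyFormsBr hij x y = L.polyFormsD hk (H.polyFormsMap hn x y) +
      H.polyFormsMap h₁ (L.polyFormsD hi x) y +
      i.negOnePow • H.polyFormsMap h₂ x (L.polyFormsD hj y) := by
  refine Prod.ext (H.poly_homotopy hij hn hk hi hj h₁ h₂ x.1 y.1) ?_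
  simp only [polyFormsBr_apply, polyFormsD_apply, polyFormsMap_apply, Prod.snd_add, Prod.smul_snd,
    map_neg, map_sub, LinearMap.sub_apply, smul_sub]
  rw [H.polyDeriv_poly (i' := i' - 1) (j' := j' - 1) (by omega) (by omega) (by omega)
      hn (by omega) (by omega) x.1 y.1,
    H.poly_homotopy (n := n - 1) (i' := i' - 1) (j' := j') (by omega) (by omega) (by omega)
      (by omega) hj (by omega) (by omega) x.2 y.1,
    polyD_units_smul,
    H.poly_homotopy (n := n - 1) (i' := i') (j' := j' - 1) (by omega) (by omega) (by omega) hi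
      (by omega) (by omega) (by omega) x.1 y.2]
  subst hi
  rcases Int.even_or_odd i with hi | hi
  · simp [Int.negOnePow_even, Int.negOnePow_odd, hi, hi.add_one, hi.sub_odd odd_one]
    abel
  · simp [Int.negOnePow_even, Int.negOnePow_odd, hi, hi.add_one, hi.sub_odd odd_one]
    abel

set_option maxHeartbeats 1000000 in
theorem polyFormsMap_cyclic {i j k n ij jk ki ij' jk' ki' : ℤ} (hij : i + j - 1 = ij)
    (hjk : j + k - 1 = jk) (hki : k + i - 1 = ki) (h₁ : ij + k = n) (h₂ : jk + i = n)
    (h₃ : ki + j = n) (hij' : i + j = ij') (hjk' : j + k = jk') (hki' : k + i = ki')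
    (h₁' : ij' + k - 1 = n) (h₂' : jk' + i - 1 = n) (h₃' : ki' + j - 1 = n)
    (x : (K[X] ⊗[K] L i) × (K[X] ⊗[K] L (i - 1)))
    (y : (K[X] ⊗[K] L j) × (K[X] ⊗[K] L (j - 1)))
    (z : (K[X] ⊗[K] L k) × (K[X] ⊗[K] L (k - 1))) :
    (L.polyFormsBr h₁ (H.polyFormsMap hij x y) z +
      (i * (j + k)).negOnePow • L.polyFormsBr h₂ (H.polyFormsMap hjk y z) x +
      (k * (i + j)).negOnePow • L.polyFormsBr h₃ (H.polyFormsMap hki z x) y) +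
    (H.polyFormsMap h₁' (L.polyFormsBr hij' x y) z +
      (i * (j + k)).negOnePow • H.polyFormsMap h₂' (L.polyFormsBr hjk' y z) x +
      (k * (i + j)).negOnePow • H.polyFormsMap h₃' (L.polyFormsBr hki' z x) y) = 0 := by
  refine Prod.ext (H.poly_cyclic hij hjk hki h₁ h₂ h₃ hij' hjk' hki' h₁' h₂' h₃' x.1 y.1 z.1) ?_
  have e₁ := H.poly_cyclic (n := n - 1) (ij := ij - 1) (jk := jk) (ki := ki - 1)
    (ij' := ij' - 1) (jk' := jk') (ki' := ki' - 1)
    (by omega) (by omega) (by omega) (by omega) (by omega) (by omega) (by omega) (by omega)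
    (by omega) (by omega) (by omega) (by omega) x.2 y.1 z.1
  have e₂ := H.poly_cyclic (n := n - 1) (ij := ij - 1) (jk := jk - 1) (ki := ki)
    (ij' := ij' - 1) (jk' := jk' - 1) (ki' := ki')
    (by omega) (by omega) (by omega) (by omega) (by omega) (by omega) (by omega) (by omega)
    (by omega) (by omega) (by omega) (by omega) x.1 y.2 z.1
  have e₃ := H.poly_cyclic (n := n - 1) (ij := ij) (jk := jk - 1) (ki := ki - 1)
    (ij' := ij') (jk' := jk' - 1) (ki' := ki' - 1)
    (by omega) (by omega) (by omega) (by omega) (by omega) (by omega) (by omega) (by omega)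
    (by omega) (by omega) (by omega) (by omega) x.1 y.1 z.2
  have key := congrArg₂ (· + ·) (congrArg₂ (· + ·) (congrArg (- ·) e₁)
    (congrArg (fun v => -(i.negOnePow • v)) e₂))
    (congrArg (fun v => -((i + j).negOnePow • v)) e₃)
  simp only [add_zero, smul_zero, neg_zero] at key
  rw [Prod.snd_zero, ← key]
  clear key e₁ e₂ e₃
  simp only [polyFormsBr_apply, polyFormsMap_apply, Prod.snd_add, Prod.smul_snd, map_add, map_sub,
    map_neg, smul_add, smul_sub,
    smul_neg, LinearMap.add_apply, LinearMap.sub_apply, LinearMap.neg_apply]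
  subst hij hjk hki hij' hjk' hki'
  rcases Int.even_or_odd i with hi | hi <;> rcases Int.even_or_odd j with hj | hj <;>
  rcases Int.even_or_odd k with hk | hk <;>
  simp [Int.negOnePow_add, Int.negOnePow_sub, Int.negOnePow_even, Int.negOnePow_odd, hi, hj, hk,
    Int.even_mul, Int.even_add, Int.odd_add, Int.even_sub,
    sub_mul, mul_sub, mul_add] <;> abel

/-- The bracket homotopy on polynomial forms. -/
noncomputable def polyForms : BracketHomotopy L.polyForms where
  h h := H.polyFormsMap h
  antisymm hij hji x y := H.polyFormsMap_antisymm hij hji x y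
  homotopy hij hn hk hi hj h₁ h₂ x y := H.polyFormsMap_homotopy hij hn hk hi hj h₁ h₂ x y
  cyclic hij hjk hki h₁ h₂ h₃ hij' hjk' hki' h₁' h₂' h₃' x y z :=
    H.polyFormsMap_cyclic hij hjk hki h₁ h₂ h₃ hij' hjk' hki' h₁' h₂' h₃' x y z

/-- The bracket homotopy on the homotopy fibre of the inclusion of a subalgebra closed under the
given bracket homotopy. -/
noncomputable def homotopyFiber (M : L.Sub)
    (hM : ∀ {i j k : ℤ} (h : i + j - 1 = k) {a : L i} {b : L j},
      a ∈ M.carrier i → b ∈ M.carrier j → H.h h a b ∈ M.carrier k) :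
    BracketHomotopy (DGLA.homotopyFiber M.incl) :=
  ((H.sub M hM).prod H.polyForms).sub (homotopyFiberSub M.incl) (by
    intro i j k h a b ha hb
    obtain ⟨h0, h1⟩ := ha
    obtain ⟨-, h1'⟩ := hb
    change L.polyEval 0 i a.2.1 = 0 at h0
    change L.polyEval 1 i a.2.1 = a.1.1 at h1
    change L.polyEval 1 j b.2.1 = b.1.1 at h1'
    constructor
    · change L.polyEval 0 k (H.poly h a.2.1 b.2.1) = 0
      rw [polyEval_poly, h0, map_zero, LinearMap.zero_apply]
    · change L.polyEval 1 k (H.poly h a.2.1 b.2.1) = H.h h a.1.1 b.1.1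
      rw [polyEval_poly, h1, h1'])

end BracketHomotopy

end DGLA

theorem theorem6p1 {K : Type u} [Field K] [CharZero K] (L : DGLA.{u, w} K)
    (h : ∀ {i j k : ℤ}, i + j - 1 = k → (L i →ₗ[K] L j →ₗ[K] L k))
    (h_antisymm : ∀ {i j k : ℤ} (hij : i + j - 1 = k) (hji : j + i - 1 = k) (a : L i) (b : L j),
      h hij a b = -((i * j).negOnePow • h hji b a))
    (h_homotopy : ∀ {i j k : ℤ} (hij : i + j = k) (a : L i) (b : L j),
      L.br hij a b =
        L.d (i := i + j - 1) (by omega) (h rfl a b) +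
          h (i := i + 1) (by omega) (L.d rfl a) b +
          i.negOnePow • h (j := j + 1) (by omega) a (L.d rfl b))
    (h_cyclic : ∀ {i j k n : ℤ} (_ : i + j + k - 1 = n) (a : L i) (b : L j) (c : L k),
      (L.br (i := i + j - 1) (by omega) (h rfl a b) c +
        (i * (j + k)).negOnePow • L.br (i := j + k - 1) (by omega) (h rfl b c) a +
        (k * (i + j)).negOnePow • L.br (i := k + i - 1) (by omega) (h rfl c a) b) +
      (h (i := i + j) (by omega) (L.br rfl a b) c +
        (i * (j + k)).negOnePow • h (i := j + k) (by omega) (L.br rfl b c) a +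
        (k * (i + j)).negOnePow • h (i := k + i) (by omega) (L.br rfl c a) b) = (0 : L n)) :
    L.IsHomotopyAbelian ∧
      ∀ M : L.Sub,
        (∀ {i j k : ℤ} (hij : i + j - 1 = k) (a : L i) (b : L j),
          a ∈ M.carrier i → b ∈ M.carrier j → h hij a b ∈ M.carrier k) →
        M.toDGLA.IsHomotopyAbelian ∧ (DGLA.homotopyFiber M.incl).IsHomotopyAbelian := by
  let H : DGLA.BracketHomotopy L :=
    { h := h
      antisymm := h_antisymm
      homotopy := fun hij hn hk hi hj h₁ h₂ a b => by
        subst hn hi hj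
        exact h_homotopy hij a b
      cyclic := fun hij hjk hki h₁ h₂ h₃ hij' hjk' hki' h₁' h₂' h₃' a b c => by
        subst hij hjk hki hij' hjk' hki'
        exact h_cyclic (by omega) a b c }
  refine ⟨H.isHomotopyAbelian, fun M hM => ?_⟩
  have hM {i j k : ℤ} (hij : i + j - 1 = k) {a : L i} {b : L j} (ha : a ∈ M.carrier i)
      (hb : b ∈ M.carrier j) : H.h hij a b ∈ M.carrier k := hM hij a b ha hb
  exact ⟨(H.sub M hM).isHomotopyAbelian, (H.homotopyFiber M hM).isHomotopyAbelian⟩
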